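/- Let $d\ge 0$ be an integer, let $U$ be a random variable with law $\mathbb P$ on a measurable space $\mathsf U$, and let $\ell:\mathbb R^d\times\mathsf U\to\mathbb R$ be jointly measurable. For $\gamma>0$ let $\phi_{d,\gamma}(x)=(2\pi\gamma)^{-d/2}e^{-\|x\|^2/(2\gamma)}$ be the density of $\mathcal N_d(0,\gamma I)$. Define the Gaussian smoothing (case $\psi(x)=x$) and the log-sum-exp smoothing (case $\psi(x)=e^{-x}$) of $\ell$ by $$\bar\ell_\gamma(\theta,u)=\int_{\mathbb R^d}\ell(x,u)\,\phi_{d,\gamma}(x-\theta)\,\mathrm dx,\qquad \ell_\gamma(\theta,u)=-\log\int_{\mathbb R^d}e^{-\ell(x,u)}\,\phi_{d,\gamma}(x-\theta)\,\mathrm dx .$$ Assume the following. (A1) $\ell(\theta,U)$ is integrable for every $\theta\in\mathbb R^d$, and $\inf_{\theta\in\mathbb R^d}\mathbb E[\ell(\theta,U)]>-\infty$. (A3) $\alpha\in[0,1]$, $\beta\in[\alpha,2]$, $\upsilon\in(0,1]$ and a measurable $J:\mathsf U\to[0,\infty)$ are such that $$|\ell(\theta,u)-\ell(\theta',u)|\le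 J(u)\big(\|\theta-\theta'\|^\alpha+\|\theta-\theta'\|^\beta\big)\quad\text{for all }\theta,\theta'\in\mathbb R^d,\ u\in\mathsf U,$$ and $\mathbb E\big[\int_{\mathbb R}e^{\upsilon J(U)(1+|z|^\beta)}\phi_{1,1}(z)\,\mathrm dz\big]<\infty$. For a family of functions $\mathcal L_\gamma:\mathbb R^d\times\mathsf U\to\mathbb R$ and $\eta>0$, consider the following two properties. (S1) There are $c\in\mathbb R$ and $\bar\gamma_1>0$ such that, for all $\theta\in\mathbb R^d$ and all $\gamma\in(0,\bar\gamma_1]$, $\mathcal L_\gamma(\theta,U)$ is integrable and $\mathbb E[\mathcal L_\gamma(\theta,U)]\ge c$. (S2) with the above $\alpha$ and with moment order $\eta$: there are a measurable $C:\mathsf U\to[1,\infty)$ with $\mathbb E[C(U)^\eta]<\infty$ and a $\bar\gamma_2\in(0,\infty]$ such that, for all reals $0<\tilde\gamma\le\gamma\le\bar\gamma_2$, all $\theta,\theta'\in\mathbb R^d$ and all $u\in\mathsf U$, the function $\mathcal L_\gamma(\cdot,u)$ is differentiable and 1. $\|\nabla\mathcal L_\gamma(\theta,u)\|\le\gamma^{\frac{\alpha-1}2}C(u)$,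 2. $\|\nabla\mathcal L_\gamma(\theta,u)-\nabla\mathcal L_\gamma(\theta',u)\|\le\gamma^{-1+\frac\alpha2}\|\theta-\theta'\|\,C(u)$, 3. $|\mathcal L_{\tilde\gamma}(\theta,u)-\mathcal L_\gamma(\theta,u)|\le(\gamma/\tilde\gamma)^{d/2}\,\frac{\gamma-\tilde\gamma}{\tilde\gamma}\,C(u)$, 4. $\|\nabla\mathcal L_{\tilde\gamma}(\theta,u)-\nabla\mathcal L_\gamma(\theta,u)\|\le\gamma^{1/2}(\gamma/\tilde\gamma)^{d/2}\,\frac{\gamma-\tilde\gamma}{\tilde\gamma^2}\,C(u)$. Then, for both choices $\mathcal L_\gamma=\bar\ell_\gamma$ and $\mathcal L_\gamma=\ell_\gamma$: the integral defining $\mathcal L_\gamma(\theta,u)$ converges absolutely for all $\gamma>0$, $\theta\in\mathbb R^d$ and $u\in\mathsf U$; (S1) holds; and (S2) holds for every $\eta>0$. -/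

import Mathlib

open MeasureTheory ProbabilityTheory Set

noncomputable section

namespace Smoothing

/-- The density at `x` of the Gaussian distribution `N_d(0, γ I)`, for `γ > 0`. -/
def gaussianDensity (d : ℕ) (γ : ℝ) (x : EuclideanSpace ℝ (Fin d)) : ℝ :=
  (2 * Real.pi * γ) ^ (-(d : ℝ) / 2) * Real.exp (-‖x‖ ^ 2 / (2 * γ))

/-- Gaussian smoothing, the case `ψ(x) = x`:
`(γ, θ, u) ↦ ∫ ℓ(x,u) φ_{d,γ}(x - θ) dx`. -/
def gaussianSmoothing {d : ℕ} {U : Type*} (ell : EuclideanSpace ℝ (Fin d) → U → ℝ)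
    (γ : ℝ) (θ : EuclideanSpace ℝ (Fin d)) (u : U) : ℝ :=
  ∫ x, ell x u * gaussianDensity d γ (x - θ)

/-- Log-sum-exp smoothing, the case `ψ(x) = exp(-x)`:
`(γ, θ, u) ↦ -log ∫ exp(-ℓ(x,u)) φ_{d,γ}(x - θ) dx`. -/
def logSumExpSmoothing {d : ℕ} {U : Type*} (ell : EuclideanSpace ℝ (Fin d) → U → ℝ)
    (γ : ℝ) (θ : EuclideanSpace ℝ (Fin d)) (u : U) : ℝ :=
  -Real.log (∫ x, Real.exp (-ell x u) * gaussianDensity d γ (x - θ))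

/-- The objective `l(θ) = E[ℓ(θ,U)]` is a real-valued function (every `ℓ(θ,U)` is integrable)
and it is bounded from below. -/
def LowerBounded {d : ℕ} {U : Type*} [MeasurableSpace U] (P : Measure U)
    (ell : EuclideanSpace ℝ (Fin d) → U → ℝ) : Prop :=
  (∀ θ, Integrable (ell θ) P) ∧ BddBelow (range fun θ => ∫ u, ell θ u ∂P)

/-- The Hölder condition with exponents `α` (local) and `β` (global) and random constant `J`,
where `J` has the exponential moment `E[∫ exp(υ J(U) (1 + |z|^β)) φ_{1,1}(z) dz] < ∞`. -/
structure HolderExpMoment {d : ℕ} {U : Type*} [MeasurableSpace U] (P : Measure U)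
    (ell : EuclideanSpace ℝ (Fin d) → U → ℝ) (α β υ : ℝ) (J : U → ℝ) : Prop where
  alpha_mem : α ∈ Icc (0 : ℝ) 1
  beta_mem : β ∈ Icc α 2
  upsilon_mem : υ ∈ Ioc (0 : ℝ) 1
  nonneg : ∀ u, 0 ≤ J u
  holder : ∀ θ θ' u, |ell θ u - ell θ' u| ≤ J u * (‖θ - θ'‖ ^ α + ‖θ - θ'‖ ^ β)
  moment : ∫⁻ u, ∫⁻ z : ℝ, ENNReal.ofReal (Real.exp (υ * J u * (1 + |z| ^ β)))
    ∂(gaussianReal 0 1) ∂P < ⊤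

/-- The averaged smoothed functions `θ ↦ E[L_γ(θ,U)]` are well defined and uniformly bounded
from below, for all small `γ`. -/
def SmoothedLowerBound {d : ℕ} {U : Type*} [MeasurableSpace U] (P : Measure U)
    (L : ℝ → EuclideanSpace ℝ (Fin d) → U → ℝ) : Prop :=
  ∃ c γ₁ : ℝ, 0 < γ₁ ∧ ∀ θ, ∀ γ ∈ Ioc (0 : ℝ) γ₁,
    Integrable (L γ θ) P ∧ c ≤ ∫ u, L γ θ u ∂P

/-- The regularity of the smoothed functions in `θ` and in `γ`, with exponent `α` and with a
random constant `C(U)` that has a finite moment of order `η`.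
The differentiability that the gradients presuppose is part of the condition. -/
def SmoothedRegularity {d : ℕ} {U : Type*} [MeasurableSpace U] (P : Measure U)
    (L : ℝ → EuclideanSpace ℝ (Fin d) → U → ℝ) (α η : ℝ) : Prop :=
  α ∈ Icc (0 : ℝ) 1 ∧
  ∃ C : U → ℝ, ∃ γ₂ : EReal, 0 < γ₂ ∧
    Measurable C ∧ (∀ u, 1 ≤ C u) ∧ Integrable (fun u => C u ^ η) P ∧
    ∀ γ' γ : ℝ, 0 < γ' → γ' ≤ γ → (γ : EReal) ≤ γ₂ →
      ∀ θ θ' : EuclideanSpace ℝ (Fin d), ∀ u : U,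
        Differentiable ℝ (fun t => L γ t u) ∧
        ‖gradient (fun t => L γ t u) θ‖ ≤ γ ^ ((α - 1) / 2) * C u ∧
        ‖gradient (fun t => L γ t u) θ - gradient (fun t => L γ t u) θ'‖
          ≤ γ ^ (-1 + α / 2) * ‖θ - θ'‖ * C u ∧
        |L γ' θ u - L γ θ u| ≤ (γ / γ') ^ ((d : ℝ) / 2) * ((γ - γ') / γ') * C u ∧
        ‖gradient (fun t => L γ' t u) θ - gradient (fun t => L γ t u) θ‖
          ≤ γ ^ ((1 : ℝ) / 2) * (γ / γ') ^ ((d : ℝ) / 2) * ((γ - γ') / γ' ^ 2) * C u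

end Smoothing

end

/-! Everything rests on one growth estimate. Chaining the Hölder condition along `⌈‖z‖⌉` steps of
length at most `s ≤ 1`, where both powers are at most `s ^ α`, shows that `f z = ℓ(θ + √γ z, u) -
ℓ(θ, u)` satisfies `|f z| ≤ K (1 + ‖z‖)` with `K = 2 J(u) γ^(α/2)`, for every `γ ≤ 1`
(`abs_sub_le_of_holder`). So in standard Gaussian coordinates the increments are linear in `z` and
carry the factor `γ^(α/2)`.

Derivatives in `θ` and `γ` of the Gaussian integral of `w` fall on the kernel. After the rescaling
`x = θ + √γ z` they are powers of `√γ` times integrals of `w(θ + √γ z)` against the weights `z`, `z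
⊗ z - 1`, `(‖z‖² - d)/2` and `z (‖z‖² - d)/2`. Each weight has Gaussian mean zero, so a constant may
be subtracted from `w`. For `w = ℓ` only `f` remains, which gives the factor `K`.

For `w = exp(-ℓ)` the same integrals are needed relative to the mass `∫ exp(-f)`, and with a
constant polynomial in `K`, because `J` has only some exponential moment. This is
`exists_tilt_bounds`: Jensen bounds the mass below by `exp(-K m)`, where `m` is the mean of `1 +
‖z‖`. Where `1 + ‖z‖` is at most a multiple of `1 + K`, the weight is polynomial in `K`. Beyond
that, the Gaussian decay beats `exp(K (1 + ‖z‖))` and leaves a spare factor `exp(-K m)`, which the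
mass absorbs. For `K ≤ 1` one also subtracts `1` from `exp(-f)` to gain the factor `K`. Derivatives
of the logarithm are then quadratic in relative quantities.

The resulting constant is `A (1 + J)^8`, all of whose moments are finite. Mean value inequalities
turn the derivative bounds into (S2), and the bound of `L_γ - ℓ` by a multiple of `(1 + 2J)²` gives
(S1). -/

noncomputable section

namespace Smoothing

/-! ### Gaussian integrals of functions of exponential growth, and differentiation under the
integral. -/

section Kernel

/-- A measurable function of at most exponential growth. -/
def ExpGrowth {d : ℕ} (w : EuclideanSpace ℝ (Fin d) → ℝ) : Prop :=
  Measurable w ∧ ∃ A B : ℝ, 0 ≤ A ∧ 0 ≤ B ∧ ∀ x, |w x| ≤ A * Real.exp (B * ‖x‖)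

/-- The Gaussian integral of `w`, weighted by a function `p` of the centred variable. -/
def smooth {d : ℕ} {V : Type*} [NormedAddCommGroup V] [NormedSpace ℝ V]
    (w : EuclideanSpace ℝ (Fin d) → ℝ) (p : EuclideanSpace ℝ (Fin d) → V)
    (γ : ℝ) (θ : EuclideanSpace ℝ (Fin d)) : V :=
  ∫ x, (w x * gaussianDensity d γ (x - θ)) • p (x - θ)

/-- The standard Gaussian measure on `ℝ^d`. -/
def stdMeasure (d : ℕ) : Measure (EuclideanSpace ℝ (Fin d)) :=
  volume.withDensity fun x => ENNReal.ofReal (gaussianDensity d 1 x)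

variable {d : ℕ} {V : Type*} [NormedAddCommGroup V] [NormedSpace ℝ V]

lemma gaussianDensity_nonneg {γ : ℝ} (hγ : 0 < γ) (x : EuclideanSpace ℝ (Fin d)) :
    0 ≤ gaussianDensity d γ x := by
  unfold gaussianDensity; positivity

lemma continuous_gaussianDensity (d : ℕ) (γ : ℝ) : Continuous (gaussianDensity d γ) := by
  unfold gaussianDensity; fun_prop

lemma integrable_exp_neg_mul_sq_norm {b : ℝ} (hb : 0 < b) :
    Integrable fun x : EuclideanSpace ℝ (Fin d) => Real.exp (-b * ‖x‖ ^ 2) := by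
  -- A non-integrable function has integral `0` by convention, whereas the closed formula is
  -- positive.
  by_contra h
  have h1 := integral_undef h
  rw [GaussianFourier.integral_rexp_neg_mul_sq_norm hb] at h1
  have : 0 < (Real.pi / b) ^ ((Module.finrank ℝ (EuclideanSpace ℝ (Fin d)) : ℝ) / 2) := by
    positivity
  exact this.ne' h1

/-- One dominating function for all `θ` and `γ` near a given point, as differentiation under the
integral requires. Half of the Gaussian exponent absorbs the exponential growth by completing the
square, and the other half survives the move of the centre from `θ` to `θ₀`. The power `3` is the
highest degree of a weight that occurs. -/
lemma exp_mul_gaussianDensity_mul_le (θ₀ : EuclideanSpace ℝ (Fin d)) {γ₀ B : ℝ} (hγ₀ : 0 < γ₀)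
    (hB : 0 ≤ B) :
    ∃ C : ℝ, 0 ≤ C ∧ ∀ θ ∈ Metric.ball θ₀ 1, ∀ γ ∈ Ioo (γ₀ / 2) (2 * γ₀), ∀ x,
      Real.exp (B * ‖x‖) * gaussianDensity d γ (x - θ) * (1 + ‖x - θ‖) ^ 3
        ≤ C * Real.exp (-(1 / (16 * γ₀)) * ‖x - θ₀‖ ^ 2) := by
  refine ⟨(Real.pi * γ₀) ^ (-(d : ℝ) / 2) * 6 *
    Real.exp (B * (‖θ₀‖ + 1) + 1 + 2 * γ₀ * (B + 1) ^ 2 + 1 / (8 * γ₀)), by positivity, ?_⟩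
  intro θ hθ γ hγ x
  have hγpos : 0 < γ := by linarith [hγ.1]
  set r := ‖x - θ‖ with hr
  have hr0 : 0 ≤ r := norm_nonneg _
  have hθ1 : ‖θ - θ₀‖ < 1 := by simpa [dist_eq_norm] using hθ
  have hx : ‖x‖ ≤ ‖θ₀‖ + 1 + r := by
    have : x = (x - θ) + (θ - θ₀) + θ₀ := by abel
    calc ‖x‖ = ‖(x - θ) + (θ - θ₀) + θ₀‖ := by rw [← this]
      _ ≤ ‖x - θ‖ + ‖θ - θ₀‖ + ‖θ₀‖ := norm_add₃_le
      _ ≤ _ := by linarith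
  have hx0 : ‖x - θ₀‖ ≤ r + 1 := by
    have : x - θ₀ = (x - θ) + (θ - θ₀) := by abel
    rw [this]; exact (norm_add_le _ _).trans (by linarith)
  have hc : (2 * Real.pi * γ) ^ (-(d : ℝ) / 2) ≤ (Real.pi * γ₀) ^ (-(d : ℝ) / 2) := by
    apply Real.rpow_le_rpow_of_nonpos (by positivity)
    · nlinarith [Real.pi_pos, hγ.1]
    · have : (0 : ℝ) ≤ d := Nat.cast_nonneg d
      linarith
  have hp : (1 + r) ^ 3 ≤ 6 * Real.exp (1 + r) := by
    have := Real.pow_div_factorial_le_exp (1 + r) (by linarith) 3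
    norm_num [Nat.factorial] at this
    linarith
  have e1 : -r ^ 2 / (2 * γ) ≤ -(r ^ 2 / (4 * γ₀)) := by
    rw [neg_div]
    apply neg_le_neg
    apply div_le_div_of_nonneg_left (by positivity) (by positivity) (by linarith [hγ.2])
  have e2 : (B + 1) * r ≤ 2 * γ₀ * (B + 1) ^ 2 + r ^ 2 / (8 * γ₀) := by
    have h : 0 ≤ (r - 4 * γ₀ * (B + 1)) ^ 2 / (8 * γ₀) := by positivity
    have h2 : (r - 4 * γ₀ * (B + 1)) ^ 2 / (8 * γ₀)
        = r ^ 2 / (8 * γ₀) - (B + 1) * r + 2 * γ₀ * (B + 1) ^ 2 := by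
      field_simp; ring
    linarith
  have e3 : -(r ^ 2 / (8 * γ₀)) ≤ -(1 / (16 * γ₀)) * ‖x - θ₀‖ ^ 2 + 1 / (8 * γ₀) := by
    have h1 : ‖x - θ₀‖ ^ 2 ≤ 2 * r ^ 2 + 2 := by
      nlinarith [norm_nonneg (x - θ₀), sq_nonneg (r - 1)]
    have h2 : (1 / (16 * γ₀)) * ‖x - θ₀‖ ^ 2 ≤ (1 / (16 * γ₀)) * (2 * r ^ 2 + 2) := by gcongr
    have h3 : (1 / (16 * γ₀)) * (2 * r ^ 2 + 2) = r ^ 2 / (8 * γ₀) + 1 / (8 * γ₀) := by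
      field_simp; ring
    linarith
  have e4 : r ^ 2 / (4 * γ₀) = r ^ 2 / (8 * γ₀) + r ^ 2 / (8 * γ₀) := by field_simp; ring
  have e5 : B * ‖x‖ ≤ B * (‖θ₀‖ + 1 + r) := by gcongr
  unfold gaussianDensity
  calc Real.exp (B * ‖x‖) * ((2 * Real.pi * γ) ^ (-(d : ℝ) / 2) * Real.exp (-‖x - θ‖ ^ 2 / (2 * γ)))
        * (1 + r) ^ 3
      ≤ Real.exp (B * ‖x‖) * ((Real.pi * γ₀) ^ (-(d : ℝ) / 2) * Real.exp (-r ^ 2 / (2 * γ)))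
        * (6 * Real.exp (1 + r)) := by gcongr
    _ = (Real.pi * γ₀) ^ (-(d : ℝ) / 2) * 6 * Real.exp (B * ‖x‖ + -r ^ 2 / (2 * γ) + (1 + r)) := by
        rw [Real.exp_add (B * ‖x‖ + _), Real.exp_add (B * ‖x‖)]; ring
    _ ≤ (Real.pi * γ₀) ^ (-(d : ℝ) / 2) * 6 * Real.exp
        ((B * (‖θ₀‖ + 1) + 1 + 2 * γ₀ * (B + 1) ^ 2 + 1 / (8 * γ₀))
          + -(1 / (16 * γ₀)) * ‖x - θ₀‖ ^ 2) := by
        apply mul_le_mul_of_nonneg_left _ (by positivity)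
        apply Real.exp_le_exp.2
        linarith
    _ = _ := by rw [Real.exp_add]; ring

lemma ExpGrowth.norm_smul_le {w : EuclideanSpace ℝ (Fin d) → ℝ} (hw : ExpGrowth w)
    (θ₀ : EuclideanSpace ℝ (Fin d)) {γ₀ : ℝ} (hγ₀ : 0 < γ₀) :
    ∃ C : ℝ, 0 ≤ C ∧ ∀ θ ∈ Metric.ball θ₀ 1, ∀ γ ∈ Ioo (γ₀ / 2) (2 * γ₀), ∀ x,
      ∀ (a : ℝ) (v : V), 0 ≤ a → ‖v‖ ≤ a * (1 + ‖x - θ‖) ^ 3 →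
      ‖(w x * gaussianDensity d γ (x - θ)) • v‖
        ≤ C * a * Real.exp (-(1 / (16 * γ₀)) * ‖x - θ₀‖ ^ 2) := by
  obtain ⟨-, A, B, hA, hB, hAB⟩ := hw
  obtain ⟨C, hC, h⟩ := exp_mul_gaussianDensity_mul_le θ₀ hγ₀ hB
  refine ⟨A * C, by positivity, fun θ hθ γ hγ x a v ha hv => ?_⟩
  have hg := gaussianDensity_nonneg (d := d) (γ := γ) (by linarith [hγ.1]) (x - θ)
  rw [norm_smul, Real.norm_eq_abs, abs_mul, abs_of_nonneg hg]
  calc |w x| * gaussianDensity d γ (x - θ) * ‖v‖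
      ≤ (A * Real.exp (B * ‖x‖)) * gaussianDensity d γ (x - θ) * (a * (1 + ‖x - θ‖) ^ 3) := by
        gcongr; exact hAB x
    _ = A * a * (Real.exp (B * ‖x‖) * gaussianDensity d γ (x - θ) * (1 + ‖x - θ‖) ^ 3) := by ring
    _ ≤ A * a * (C * Real.exp (-(1 / (16 * γ₀)) * ‖x - θ₀‖ ^ 2)) := by
        exact mul_le_mul_of_nonneg_left (h θ hθ γ hγ x) (by positivity)
    _ = _ := by ring

lemma ExpGrowth.aestronglyMeasurable_smul {w : EuclideanSpace ℝ (Fin d) → ℝ} (hw : ExpGrowth w)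
    {p : EuclideanSpace ℝ (Fin d) → V} (hp : Continuous p) (γ : ℝ)
    (θ : EuclideanSpace ℝ (Fin d)) :
    AEStronglyMeasurable (fun x => (w x * gaussianDensity d γ (x - θ)) • p (x - θ)) volume := by
  refine AEStronglyMeasurable.smul ?_ ?_
  · exact (hw.1.aestronglyMeasurable).mul
      ((continuous_gaussianDensity d γ).comp (by fun_prop)).aestronglyMeasurable
  · exact (hp.comp (by fun_prop : Continuous fun x => x - θ)).aestronglyMeasurable

lemma ExpGrowth.integrable_smul {w : EuclideanSpace ℝ (Fin d) → ℝ} (hw : ExpGrowth w)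
    {p : EuclideanSpace ℝ (Fin d) → V} (hp : Continuous p) {a : ℝ} (ha : 0 ≤ a)
    (hpa : ∀ y, ‖p y‖ ≤ a * (1 + ‖y‖) ^ 3) {γ : ℝ} (hγ : 0 < γ)
    (θ : EuclideanSpace ℝ (Fin d)) :
    Integrable (fun x => (w x * gaussianDensity d γ (x - θ)) • p (x - θ)) := by
  obtain ⟨C, hC, h⟩ := hw.norm_smul_le (V := V) θ hγ
  have hi : Integrable (fun x => C * a * Real.exp (-(1 / (16 * γ)) * ‖x - θ‖ ^ 2)) :=
    ((integrable_exp_neg_mul_sq_norm (by positivity)).comp_sub_right θ).const_mul _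
  refine hi.mono' (hw.aestronglyMeasurable_smul hp γ θ) (ae_of_all _ fun x => ?_)
  exact h θ (Metric.mem_ball_self one_pos) γ ⟨by linarith, by linarith⟩ x a _ ha (hpa _)

/-- The weight of the derivative of `smooth w (fun y => a + T y) γ`. -/
def derivWeight (γ : ℝ) (a : V) (T : EuclideanSpace ℝ (Fin d) →L[ℝ] V)
    (y : EuclideanSpace ℝ (Fin d)) : EuclideanSpace ℝ (Fin d) →L[ℝ] V :=
  γ⁻¹ • (innerSL ℝ y).smulRight (a + T y) - T

lemma continuous_derivWeight (γ : ℝ) (a : V) (T : EuclideanSpace ℝ (Fin d) →L[ℝ] V) :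
    Continuous (derivWeight γ a T) := by
  have h : Continuous fun y : EuclideanSpace ℝ (Fin d) =>
      ContinuousLinearMap.smulRightL ℝ (EuclideanSpace ℝ (Fin d)) V (innerSL ℝ y) (a + T y) := by
    fun_prop
  exact (h.const_smul γ⁻¹).sub continuous_const

lemma norm_derivWeight_le {γ : ℝ} (hγ : 0 < γ) (a : V) (T : EuclideanSpace ℝ (Fin d) →L[ℝ] V)
    (y : EuclideanSpace ℝ (Fin d)) :
    ‖derivWeight γ a T y‖ ≤ (γ⁻¹ * (‖a‖ + ‖T‖) + ‖T‖) * (1 + ‖y‖) ^ 3 := by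
  have hy := norm_nonneg y
  have h1 : ‖a + T y‖ ≤ (‖a‖ + ‖T‖) * (1 + ‖y‖) := by
    refine (norm_add_le _ _).trans ?_
    nlinarith [T.le_opNorm y, norm_nonneg a, norm_nonneg T,
      mul_nonneg (norm_nonneg a) (norm_nonneg y)]
  have h2 : (1 + ‖y‖) * (1 + ‖y‖) ≤ (1 + ‖y‖) ^ 3 := by
    rw [← sq]; exact pow_le_pow_right₀ (by linarith) (by norm_num)
  calc ‖derivWeight γ a T y‖ ≤ ‖γ⁻¹ • (innerSL ℝ y).smulRight (a + T y)‖ + ‖T‖ := norm_sub_le _ _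
    _ = γ⁻¹ * (‖y‖ * ‖a + T y‖) + ‖T‖ := by
        rw [norm_smul, ContinuousLinearMap.norm_smulRight_apply, innerSL_apply_norm,
          Real.norm_of_nonneg (by positivity)]
    _ ≤ γ⁻¹ * ((1 + ‖y‖) * ((‖a‖ + ‖T‖) * (1 + ‖y‖))) + ‖T‖ * 1 := by
        rw [mul_one]; gcongr; linarith
    _ = γ⁻¹ * (‖a‖ + ‖T‖) * ((1 + ‖y‖) * (1 + ‖y‖)) + ‖T‖ * 1 := by ring
    _ ≤ γ⁻¹ * (‖a‖ + ‖T‖) * (1 + ‖y‖) ^ 3 + ‖T‖ * (1 + ‖y‖) ^ 3 := by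
        gcongr; exact one_le_pow₀ (by linarith)
    _ = _ := by ring

/-- The kernel contributes `γ⁻¹ ⟨x - θ, ·⟩` times the weight, and the affine weight itself
contributes `-T`. -/
lemma hasFDerivAt_gaussianDensity_smul (γ : ℝ) (c : ℝ) (a : V)
    (T : EuclideanSpace ℝ (Fin d) →L[ℝ] V) (x θ : EuclideanSpace ℝ (Fin d)) :
    HasFDerivAt (fun θ => (c * gaussianDensity d γ (x - θ)) • (a + T (x - θ)))
      ((c * gaussianDensity d γ (x - θ)) • derivWeight γ a T (x - θ)) θ := by
  have h1 : HasFDerivAt (fun θ : EuclideanSpace ℝ (Fin d) => x - θ)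
      (-ContinuousLinearMap.id ℝ (EuclideanSpace ℝ (Fin d))) θ := (hasFDerivAt_id θ).const_sub x
  have h2 := h1.norm_sq
  have h3 := ((((h2.neg.mul_const (2 * γ)⁻¹).exp).const_mul
    ((2 * Real.pi * γ) ^ (-(d : ℝ) / 2))).const_mul c)
  have h4 : HasFDerivAt (fun θ => a + T (x - θ)) (T.comp
      (-ContinuousLinearMap.id ℝ (EuclideanSpace ℝ (Fin d)))) θ :=
    (T.hasFDerivAt.comp θ h1).const_add a
  refine ((h3.smul h4).congr_fderiv ?_)
  ext h
  simp only [derivWeight, gaussianDensity, add_apply,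
    smul_apply, sub_apply,
    ContinuousLinearMap.smulRight_apply, ContinuousLinearMap.comp_apply,
    neg_apply, ContinuousLinearMap.id_apply, innerSL_apply_apply,
    smul_eq_mul, map_neg]
  simp only [div_eq_mul_inv, mul_inv]
  module

/-- Affine weights suffice: the constant weight yields the gradient of the mass, and the identity
weight its second derivative. -/
theorem ExpGrowth.hasFDerivAt_smooth [CompleteSpace V] {w : EuclideanSpace ℝ (Fin d) → ℝ}
    (hw : ExpGrowth w) (a : V) (T : EuclideanSpace ℝ (Fin d) →L[ℝ] V) {γ : ℝ} (hγ : 0 < γ)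
    (θ : EuclideanSpace ℝ (Fin d)) :
    HasFDerivAt (smooth w (fun y => a + T y) γ) (smooth w (derivWeight γ a T) γ θ) θ := by
  obtain ⟨C, hC, h⟩ := hw.norm_smul_le (V := EuclideanSpace ℝ (Fin d) →L[ℝ] V) θ hγ
  have hi : Integrable (fun x => C * (γ⁻¹ * (‖a‖ + ‖T‖) + ‖T‖) *
      Real.exp (-(1 / (16 * γ)) * ‖x - θ‖ ^ 2)) :=
    ((integrable_exp_neg_mul_sq_norm (by positivity)).comp_sub_right θ).const_mul _
  have hcont : Continuous fun y => a + T y := by fun_prop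
  refine hasFDerivAt_integral_of_dominated_of_fderiv_le
    (F' := fun θ x => (w x * gaussianDensity d γ (x - θ)) • derivWeight γ a T (x - θ))
    (Metric.ball_mem_nhds θ one_pos) (Filter.Eventually.of_forall fun θ' =>
      hw.aestronglyMeasurable_smul hcont γ θ') ?_
    (hw.aestronglyMeasurable_smul (continuous_derivWeight γ a T) γ θ)
    (ae_of_all _ fun x θ' hθ' => ?_) hi
    (ae_of_all _ fun x θ' _ => hasFDerivAt_gaussianDensity_smul γ (w x) a T x θ')
  · refine hw.integrable_smul hcont (a := ‖a‖ + ‖T‖) (by positivity) (fun y => ?_) hγ θ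
    have hy := norm_nonneg y
    calc ‖a + T y‖ ≤ ‖a‖ * 1 + ‖T‖ * ‖y‖ := by
          rw [mul_one]; exact (norm_add_le _ _).trans (by gcongr; exact T.le_opNorm y)
      _ ≤ ‖a‖ * (1 + ‖y‖) ^ 3 + ‖T‖ * (1 + ‖y‖) ^ 3 := by
          have h3 : 1 + ‖y‖ ≤ (1 + ‖y‖) ^ 3 := le_self_pow₀ (by linarith) (by norm_num)
          gcongr <;> linarith
      _ = _ := by ring
  · exact h θ' hθ' γ ⟨by linarith, by linarith⟩ x _ _ (by positivity) (norm_derivWeight_le hγ a T _)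

lemma hasDerivAt_gaussianDensity {γ : ℝ} (hγ : 0 < γ) (y : EuclideanSpace ℝ (Fin d)) :
    HasDerivAt (fun γ => gaussianDensity d γ y)
      (gaussianDensity d γ y * (‖y‖ ^ 2 / (2 * γ ^ 2) - d / (2 * γ))) γ := by
  have hpi := Real.pi_pos
  have h1 : HasDerivAt (fun γ : ℝ => 2 * Real.pi * γ) (2 * Real.pi) γ := by
    simpa using (hasDerivAt_id γ).const_mul (2 * Real.pi)
  have h2 := h1.rpow_const (p := -(d : ℝ) / 2) (Or.inl (by positivity))
  have h3 : HasDerivAt (fun γ : ℝ => 2 * γ) 2 γ := by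
    simpa using (hasDerivAt_id γ).const_mul (2 : ℝ)
  have h4 := ((h3.inv (by positivity)).const_mul (-‖y‖ ^ 2)).exp
  have h5 := h2.mul h4
  refine (h5.congr_deriv ?_)
  have e : (2 * Real.pi * γ) ^ (-(d : ℝ) / 2 - 1)
      = (2 * Real.pi * γ) ^ (-(d : ℝ) / 2) / (2 * Real.pi * γ) :=
    Real.rpow_sub_one (by positivity) _
  rw [e]
  simp only [gaussianDensity, Pi.inv_apply, div_eq_mul_inv (-‖y‖ ^ 2) _]
  generalize (2 * Real.pi * γ) ^ (-(d : ℝ) / 2) = c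
  generalize Real.exp (-‖y‖ ^ 2 * (2 * γ)⁻¹) = c'
  field_simp
  ring

/-- The `γ`-derivative multiplies the weight by a quadratic polynomial, so linear growth of `p`
keeps the product within the cubic domination. -/
theorem ExpGrowth.hasDerivAt_smooth [CompleteSpace V] {w : EuclideanSpace ℝ (Fin d) → ℝ}
    (hw : ExpGrowth w) {p : EuclideanSpace ℝ (Fin d) → V} (hp : Continuous p) {a : ℝ}
    (ha : 0 ≤ a) (hpa : ∀ y, ‖p y‖ ≤ a * (1 + ‖y‖)) {γ : ℝ} (hγ : 0 < γ)
    (θ : EuclideanSpace ℝ (Fin d)) :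
    HasDerivAt (fun γ => smooth w p γ θ)
      (smooth w (fun y => (‖y‖ ^ 2 / (2 * γ ^ 2) - d / (2 * γ)) • p y) γ θ) γ := by
  obtain ⟨C, hC, h⟩ := hw.norm_smul_le (V := V) θ hγ
  have hi : Integrable (fun x => C * ((2 / γ ^ 2 + d / γ) * a) *
      Real.exp (-(1 / (16 * γ)) * ‖x - θ‖ ^ 2)) :=
    ((integrable_exp_neg_mul_sq_norm (by positivity)).comp_sub_right θ).const_mul _
  refine (hasDerivAt_integral_of_dominated_loc_of_deriv_le
    (F' := fun γ x => (w x * gaussianDensity d γ (x - θ)) •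
      ((‖x - θ‖ ^ 2 / (2 * γ ^ 2) - d / (2 * γ)) • p (x - θ)))
    (Ioo_mem_nhds (by linarith : γ / 2 < γ) (by linarith : γ < 2 * γ))
    (Filter.Eventually.of_forall fun γ' => hw.aestronglyMeasurable_smul hp γ' θ) ?_
    (hw.aestronglyMeasurable_smul (p := fun y => (‖y‖ ^ 2 / (2 * γ ^ 2) - d / (2 * γ)) • p y)
      (by fun_prop) γ θ)
    (ae_of_all _ fun x γ' hγ' => ?_) hi
    (ae_of_all _ fun x γ' hγ' => ?_)).2
  · refine hw.integrable_smul hp ha (fun y => (hpa y).trans ?_) hγ θ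
    have hy := norm_nonneg y
    gcongr
    exact le_self_pow₀ (by linarith) (by norm_num)
  · refine h θ (Metric.mem_ball_self one_pos) γ' hγ' x _ _ (by positivity) ?_
    have hγ'0 : 0 < γ' := by linarith [hγ'.1]
    set r := ‖x - θ‖ with hr
    have hr0 : 0 ≤ r := norm_nonneg _
    have h1 : r ^ 2 / (2 * γ' ^ 2) ≤ 2 / γ ^ 2 * (1 + r) ^ 2 := by
      calc r ^ 2 / (2 * γ' ^ 2) ≤ (1 + r) ^ 2 / (2 * (γ / 2) ^ 2) := by
            gcongr
            · linarith
            · exact hγ'.1.le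
        _ = _ := by field_simp
    have h2 : (d : ℝ) / (2 * γ') ≤ d / γ * (1 + r) ^ 2 := by
      calc (d : ℝ) / (2 * γ') ≤ d / γ * 1 := by
            rw [mul_one]; gcongr; linarith [hγ'.1]
        _ ≤ _ := by gcongr; exact one_le_pow₀ (by linarith)
    have h3 : |r ^ 2 / (2 * γ' ^ 2) - d / (2 * γ')| ≤ (2 / γ ^ 2 + d / γ) * (1 + r) ^ 2 := by
      have h4 : 0 ≤ r ^ 2 / (2 * γ' ^ 2) := by positivity
      have h5 : 0 ≤ (d : ℝ) / (2 * γ') := by positivity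
      rw [abs_le]; constructor <;> linarith
    rw [norm_smul, Real.norm_eq_abs]
    calc _ ≤ ((2 / γ ^ 2 + d / γ) * (1 + r) ^ 2) * (a * (1 + r)) := by
          gcongr; exact hpa _
      _ = _ := by ring
  · have := ((hasDerivAt_gaussianDensity (d := d) (γ := γ') (by linarith [hγ'.1])
      (x - θ)).const_mul (w x)).smul_const (p (x - θ))
    refine this.congr_deriv ?_
    rw [smul_smul]; ring_nf

end Kernel

/-! ### Elementary inequalities that absorb linear exponents into `exp(r² / 4)`. -/

lemma pow_four_mul_exp_le {r : ℝ} (hr : 0 ≤ r) :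
    (1 + r) ^ 4 * Real.exp (1 + r) ≤ 24 * Real.exp 6 * Real.exp (r ^ 2 / 4) := by
  have h := Real.pow_div_factorial_le_exp (1 + r) (by linarith) 4
  norm_num [Nat.factorial] at h
  have h' : (1 + r) ^ 4 ≤ 24 * Real.exp (1 + r) := by linarith
  calc (1 + r) ^ 4 * Real.exp (1 + r) ≤ 24 * Real.exp (1 + r) * Real.exp (1 + r) := by gcongr
    _ = 24 * Real.exp ((1 + r) + (1 + r)) := by rw [mul_assoc, ← Real.exp_add]
    _ ≤ 24 * Real.exp (6 + r ^ 2 / 4) := by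
        refine mul_le_mul_of_nonneg_left (Real.exp_le_exp.2 ?_) (by norm_num)
        nlinarith [sq_nonneg (r / 2 - 2)]
    _ = _ := by rw [Real.exp_add]; ring

lemma pow_three_mul_exp_le {K r : ℝ} (hr : 0 ≤ r) :
    (1 + r) ^ 3 * Real.exp (K * (1 + r))
      ≤ 6 * Real.exp ((K + 1) + (K + 1) ^ 2) * Real.exp (r ^ 2 / 4) := by
  have h := Real.pow_div_factorial_le_exp (1 + r) (by linarith) 3
  norm_num [Nat.factorial] at h
  have h' : (1 + r) ^ 3 ≤ 6 * Real.exp (1 + r) := by linarith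
  calc (1 + r) ^ 3 * Real.exp (K * (1 + r)) ≤ 6 * Real.exp (1 + r) * Real.exp (K * (1 + r)) := by
        gcongr
    _ = 6 * Real.exp ((1 + r) + K * (1 + r)) := by rw [mul_assoc, ← Real.exp_add]
    _ ≤ 6 * Real.exp ((K + 1) + (K + 1) ^ 2 + r ^ 2 / 4) := by
        refine mul_le_mul_of_nonneg_left (Real.exp_le_exp.2 ?_) (by norm_num)
        nlinarith [sq_nonneg (r / 2 - (K + 1))]
    _ = _ := by rw [Real.exp_add]; ring

/-- Splitting of a weighted exponential according to whether `r` is large compared to `K`. -/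
lemma pow_three_mul_exp_neg_le {K r m y : ℝ} (hK : 0 ≤ K) (hr : 0 ≤ r) (hm : 0 ≤ m)
    (hy : -y ≤ K * (1 + r)) :
    (1 + r) ^ 3 * Real.exp (-y) ≤ (16 * (1 + m) * (1 + K)) ^ 3 * Real.exp (-y)
      + 24 * Real.exp 6 * Real.exp (r ^ 2 / 4) * Real.exp (-(K * m)) := by
  rcases le_or_gt (1 + r) (16 * (1 + m) * (1 + K)) with h | h
  · have : (1 + r) ^ 3 * Real.exp (-y) ≤ (16 * (1 + m) * (1 + K)) ^ 3 * Real.exp (-y) := by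
      gcongr
    have : 0 ≤ 24 * Real.exp 6 * Real.exp (r ^ 2 / 4) * Real.exp (-(K * m)) := by positivity
    linarith
  · have h0 : 0 ≤ (16 * (1 + m) * (1 + K)) ^ 3 * Real.exp (-y) := by positivity
    refine le_trans ?_ (le_add_of_nonneg_left h0)
    have h3 := Real.pow_div_factorial_le_exp (1 + r) (by linarith) 3
    norm_num [Nat.factorial] at h3
    have h3' : (1 + r) ^ 3 ≤ 24 * Real.exp (1 + r) := by nlinarith [Real.exp_pos (1 + r)]
    -- Beyond the threshold, a small part of the quadratic exponent pays for the tilt and also for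
    -- the spare `K * m`, which later matches the Jensen lower bound for the mass.
    have hA : K * (1 + r) + K * m ≤ (1 + r) ^ 2 / 16 := by
      have hk : K * (1 + m) ≤ (1 + r) / 16 := by nlinarith
      calc K * (1 + r) + K * m ≤ K * (1 + m) * (1 + r) := by
            nlinarith [mul_nonneg (mul_nonneg hK hm) hr]
        _ ≤ (1 + r) / 16 * (1 + r) := by gcongr
        _ = _ := by ring
    calc (1 + r) ^ 3 * Real.exp (-y) ≤ 24 * Real.exp (1 + r) * Real.exp (K * (1 + r)) := by gcongr
      _ = 24 * Real.exp (1 + r + K * (1 + r)) := by rw [mul_assoc, ← Real.exp_add]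
      _ ≤ 24 * Real.exp (6 + r ^ 2 / 4 + -(K * m)) := by
          refine mul_le_mul_of_nonneg_left (Real.exp_le_exp.2 ?_) (by norm_num)
          nlinarith [sq_nonneg (r - 3)]
      _ = _ := by rw [Real.exp_add, Real.exp_add]; ring

lemma abs_exp_neg_sub_one_le (y : ℝ) : |Real.exp (-y) - 1| ≤ |y| * Real.exp |y| := by
  have h1 := Real.add_one_le_exp y
  have h2 := Real.add_one_le_exp (-y)
  rcases le_total 0 y with h | h
  · rw [abs_of_nonneg h, abs_of_nonpos (by simpa using h)]
    nlinarith [Real.one_le_exp h]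
  · rw [abs_of_nonpos h, abs_of_nonneg (by simpa using h)]
    have h3 : Real.exp (-y) * Real.exp y = 1 := by rw [← Real.exp_add]; simp
    nlinarith [Real.exp_pos (-y)]

/-! ### Exponential tilts of a probability measure with a Gaussian moment. -/

section Tilt

variable {E : Type*} [NormedAddCommGroup E] [MeasurableSpace E] [BorelSpace E]
  {μ : Measure E}

lemma integrable_pow_four (hI : Integrable (fun z : E => Real.exp (‖z‖ ^ 2 / 4)) μ) :
    Integrable (fun z : E => (1 + ‖z‖) ^ 4 * Real.exp (1 + ‖z‖)) μ := by
  refine (hI.const_mul (24 * Real.exp 6)).mono'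
    (Measurable.aestronglyMeasurable (by fun_prop)) (ae_of_all _ fun z => ?_)
  rw [Real.norm_of_nonneg (by positivity)]
  exact pow_four_mul_exp_le (norm_nonneg z)

lemma integrable_pow_le (hI : Integrable (fun z : E => Real.exp (‖z‖ ^ 2 / 4)) μ) {n : ℕ}
    (hn : n ≤ 4) : Integrable (fun z : E => (1 + ‖z‖) ^ n) μ := by
  refine (integrable_pow_four hI).mono'
    (Measurable.aestronglyMeasurable (by fun_prop)) (ae_of_all _ fun z => ?_)
  rw [Real.norm_of_nonneg (by positivity)]
  have h1 : (1 : ℝ) ≤ 1 + ‖z‖ := by linarith [norm_nonneg z]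
  have h2 : 1 ≤ Real.exp (1 + ‖z‖) := Real.one_le_exp (by linarith)
  calc (1 + ‖z‖) ^ n ≤ (1 + ‖z‖) ^ 4 * 1 := by rw [mul_one]; exact pow_le_pow_right₀ h1 hn
    _ ≤ _ := by gcongr

lemma integrable_pow_three_mul_exp_neg
    (hI : Integrable (fun z : E => Real.exp (‖z‖ ^ 2 / 4)) μ) {f : E → ℝ} (hf : Measurable f)
    {K : ℝ} (hfK : ∀ z, |f z| ≤ K * (1 + ‖z‖)) :
    Integrable (fun z : E => (1 + ‖z‖) ^ 3 * Real.exp (-f z)) μ := by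
  refine (hI.const_mul (6 * Real.exp ((K + 1) + (K + 1) ^ 2))).mono'
    (Measurable.aestronglyMeasurable (by fun_prop)) (ae_of_all _ fun z => ?_)
  rw [Real.norm_of_nonneg (by positivity)]
  refine le_trans ?_ (pow_three_mul_exp_le (norm_nonneg z))
  gcongr
  exact (neg_le_abs _).trans (hfK z)

lemma integrable_exp_neg
    (hI : Integrable (fun z : E => Real.exp (‖z‖ ^ 2 / 4)) μ) {f : E → ℝ} (hf : Measurable f)
    {K : ℝ} (hfK : ∀ z, |f z| ≤ K * (1 + ‖z‖)) :
    Integrable (fun z : E => Real.exp (-f z)) μ := by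
  refine (integrable_pow_three_mul_exp_neg hI hf hfK).mono'
    (Measurable.aestronglyMeasurable (by fun_prop)) (ae_of_all _ fun z => ?_)
  rw [Real.norm_of_nonneg (by positivity)]
  exact le_mul_of_one_le_left (by positivity) (one_le_pow₀ (by linarith [norm_nonneg z]))

/-- Jensen's inequality, obtained by integrating the tangent line of `exp(-y)` at the mean `m`. -/
lemma exp_neg_le_integral_exp_neg {E : Type*} [MeasurableSpace E] {μ : Measure E}
    [IsProbabilityMeasure μ] {f : E → ℝ} (hf : Integrable f μ)
    (he : Integrable (fun z => Real.exp (-f z)) μ) :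
    Real.exp (-∫ z, f z ∂μ) ≤ ∫ z, Real.exp (-f z) ∂μ := by
  set m := ∫ z, f z ∂μ
  have h1 : ∀ z, Real.exp (-m) * (1 + m - f z) ≤ Real.exp (-f z) := fun z => by
    have : Real.exp (-f z) = Real.exp (-m) * Real.exp (m - f z) := by
      rw [← Real.exp_add]; ring_nf
    rw [this]
    gcongr
    linarith [Real.add_one_le_exp (m - f z)]
  have h2 : Integrable (fun z => Real.exp (-m) * (1 + m - f z)) μ :=
    ((integrable_const _).sub hf).const_mul _
  have h3 := integral_mono h2 he h1
  rw [integral_const_mul, integral_sub (integrable_const _) hf] at h3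
  simpa [m] using h3

lemma integrable_of_abs_le (hI : Integrable (fun z : E => Real.exp (‖z‖ ^ 2 / 4)) μ)
    {f : E → ℝ} (hf : Measurable f) {K : ℝ} (hfK : ∀ z, |f z| ≤ K * (1 + ‖z‖)) :
    Integrable f μ := by
  refine ((integrable_pow_le hI (n := 1) (by norm_num)).const_mul K).mono'
    hf.aestronglyMeasurable (ae_of_all _ fun z => ?_)
  simpa using hfK z

/-- Estimates, polynomial in `K`, for an exponential tilt of `μ` whose logarithm grows at most
like `K * (1 + ‖z‖)`. -/
theorem exists_tilt_bounds [IsProbabilityMeasure μ]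
    (hI : Integrable (fun z : E => Real.exp (‖z‖ ^ 2 / 4)) μ) :
    ∃ c : ℝ, 1 ≤ c ∧ ∀ K : ℝ, 0 ≤ K → ∀ f : E → ℝ, Measurable f →
      (∀ z, |f z| ≤ K * (1 + ‖z‖)) →
      ∫ z, (1 + ‖z‖) ^ 3 * |f z| ∂μ ≤ c * K ∧
      Real.exp (-(c * K)) ≤ ∫ z, Real.exp (-f z) ∂μ ∧
      ∫ z, Real.exp (-f z) ∂μ ≤ Real.exp (c * (1 + K) ^ 2) ∧
      ∫ z, (1 + ‖z‖) ^ 3 * Real.exp (-f z) ∂μ ≤ c * (1 + K) ^ 3 * ∫ z, Real.exp (-f z) ∂μ ∧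
      (K ≤ 1 → ∫ z, (1 + ‖z‖) ^ 3 * |Real.exp (-f z) - 1| ∂μ
        ≤ c * K * ∫ z, Real.exp (-f z) ∂μ) := by
  set I := ∫ z, Real.exp (‖z‖ ^ 2 / 4) ∂μ with hIdef
  set m := ∫ z, (1 + ‖z‖) ∂μ with hmdef
  have hw1 : Integrable (fun z : E => 1 + ‖z‖) μ := by
    simpa using integrable_pow_le hI (n := 1) (by norm_num)
  have hm0 : 0 ≤ m := integral_nonneg fun z => by positivity
  have hI1 : 1 ≤ I := by
    have h := integral_mono (integrable_const (1 : ℝ)) hI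
      (fun z => Real.one_le_exp (by positivity))
    simpa using h
  set c₁ := 24 * Real.exp 6 * I with hc₁
  have hc₁0 : 1 ≤ c₁ := by
    have : 1 ≤ Real.exp 6 := Real.one_le_exp (by norm_num)
    nlinarith
  have hbase : ∀ K : ℝ, 0 ≤ K → ∀ f : E → ℝ, Measurable f → (∀ z, |f z| ≤ K * (1 + ‖z‖)) →
      Real.exp (-(K * m)) ≤ ∫ z, Real.exp (-f z) ∂μ := by
    intro K hK f hf hfK
    have hfi := integrable_of_abs_le hI hf hfK
    refine le_trans ?_ (exp_neg_le_integral_exp_neg hfi (integrable_exp_neg hI hf hfK))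
    gcongr
    rw [hmdef, ← integral_const_mul]
    exact integral_mono hfi (hw1.const_mul K) fun z => (le_abs_self _).trans (hfK z)
  -- The summands serve the five bounds: `c₁ ≤ c₁ * exp m` the first, `m` the second, `1 + log I`
  -- the third, `(16 (1 + m))³` and `c₁` the fourth, `c₁ * exp m` the last.
  refine ⟨c₁ * Real.exp m + m + 1 + Real.log I + (16 * (1 + m)) ^ 3, ?_, ?_⟩
  · have := Real.log_nonneg hI1
    have : 0 ≤ c₁ * Real.exp m := by positivity
    have : 0 ≤ (16 * (1 + m)) ^ 3 := by positivity
    linarith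
  have hlog := Real.log_nonneg hI1
  have hem : 1 ≤ Real.exp m := Real.one_le_exp hm0
  have hce : c₁ ≤ c₁ * Real.exp m := le_mul_of_one_le_right (by linarith) hem
  have hp3 : 0 ≤ (16 * (1 + m)) ^ 3 := by positivity
  intro K hK f hf hfK
  set c := c₁ * Real.exp m + m + 1 + Real.log I + (16 * (1 + m)) ^ 3 with hc
  set M := ∫ z, Real.exp (-f z) ∂μ with hM
  have hMlow := hbase K hK f hf hfK
  have hMpos : 0 < M := lt_of_lt_of_le (Real.exp_pos _) hMlow
  have hei := integrable_exp_neg hI hf hfK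
  refine ⟨?_, ?_, ?_, ?_, ?_⟩
  · calc ∫ z, (1 + ‖z‖) ^ 3 * |f z| ∂μ
        ≤ ∫ z, (24 * Real.exp 6 * K) * Real.exp (‖z‖ ^ 2 / 4) ∂μ := by
          refine integral_mono_of_nonneg (ae_of_all _ fun z => by positivity) (hI.const_mul _)
            (ae_of_all _ fun z => ?_)
          have h4 := pow_four_mul_exp_le (norm_nonneg z)
          have h5 : (1 + ‖z‖) ^ 4 ≤ (1 + ‖z‖) ^ 4 * Real.exp (1 + ‖z‖) :=
            le_mul_of_one_le_right (by positivity) (Real.one_le_exp (by positivity))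
          calc (1 + ‖z‖) ^ 3 * |f z| ≤ (1 + ‖z‖) ^ 3 * (K * (1 + ‖z‖)) := by
                gcongr; exact hfK z
            _ = K * (1 + ‖z‖) ^ 4 := by ring
            _ ≤ K * (24 * Real.exp 6 * Real.exp (‖z‖ ^ 2 / 4)) := by
                gcongr; exact h5.trans h4
            _ = _ := by ring
      _ = c₁ * K := by rw [integral_const_mul]; ring
      _ ≤ c * K := by gcongr; linarith
  · refine le_trans ?_ hMlow
    rw [Real.exp_le_exp, neg_le_neg_iff, mul_comm]
    exact mul_le_mul_of_nonneg_right (by linarith) hK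
  · calc M ≤ ∫ z, Real.exp (K + K ^ 2) * Real.exp (‖z‖ ^ 2 / 4) ∂μ := by
          refine integral_mono hei (hI.const_mul _) fun z => ?_
          simp only [← Real.exp_add]
          gcongr
          have := (neg_le_abs _).trans (hfK z)
          nlinarith [sq_nonneg (‖z‖ / 2 - K)]
      _ = Real.exp (K + K ^ 2 + Real.log I) := by
          rw [integral_const_mul, Real.exp_add _ (Real.log I), Real.exp_log (by linarith)]
      _ ≤ Real.exp (c * (1 + K) ^ 2) := by
          gcongr
          have h1 : 1 + Real.log I ≤ c := by linarith
          have h2 : (1 + Real.log I) * (1 + K) ^ 2 ≤ c * (1 + K) ^ 2 := by gcongr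
          nlinarith [mul_nonneg hlog hK, mul_nonneg hlog (sq_nonneg K)]
  · calc ∫ z, (1 + ‖z‖) ^ 3 * Real.exp (-f z) ∂μ
        ≤ ∫ z, ((16 * (1 + m) * (1 + K)) ^ 3 * Real.exp (-f z)
          + 24 * Real.exp 6 * Real.exp (-(K * m)) * Real.exp (‖z‖ ^ 2 / 4)) ∂μ := by
          refine integral_mono (integrable_pow_three_mul_exp_neg hI hf hfK)
            ((hei.const_mul _).add (hI.const_mul _)) fun z => ?_
          have := pow_three_mul_exp_neg_le hK (norm_nonneg z) hm0
            ((neg_le_abs _).trans (hfK z))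
          refine this.trans (le_of_eq ?_)
          ring
      _ = (16 * (1 + m)) ^ 3 * (1 + K) ^ 3 * M + c₁ * Real.exp (-(K * m)) := by
          rw [integral_add (hei.const_mul _) (hI.const_mul _), integral_const_mul,
            integral_const_mul]
          ring
      -- The tail carries `exp(-(K * m))`, which is at most the mass, so it becomes a relative
      -- error.
      _ ≤ (16 * (1 + m)) ^ 3 * (1 + K) ^ 3 * M + c₁ * ((1 + K) ^ 3 * M) := by
          gcongr
          refine hMlow.trans (le_mul_of_one_le_left hMpos.le (one_le_pow₀ (by linarith)))
      _ = ((16 * (1 + m)) ^ 3 + c₁) * ((1 + K) ^ 3 * M) := by ring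
      _ ≤ c * ((1 + K) ^ 3 * M) := by gcongr; linarith
      _ = _ := by ring
  · intro hK1
    calc ∫ z, (1 + ‖z‖) ^ 3 * |Real.exp (-f z) - 1| ∂μ
        ≤ ∫ z, (24 * Real.exp 6 * K) * Real.exp (‖z‖ ^ 2 / 4) ∂μ := by
          refine integral_mono_of_nonneg (ae_of_all _ fun z => by positivity) (hI.const_mul _)
            (ae_of_all _ fun z => ?_)
          have h5 : |f z| ≤ 1 + ‖z‖ :=
            (hfK z).trans (mul_le_of_le_one_left (by positivity) hK1)
          calc (1 + ‖z‖) ^ 3 * |Real.exp (-f z) - 1|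
              ≤ (1 + ‖z‖) ^ 3 * (K * (1 + ‖z‖) * Real.exp (1 + ‖z‖)) := by
                gcongr
                refine (abs_exp_neg_sub_one_le _).trans ?_
                gcongr
                exact hfK z
            _ = K * ((1 + ‖z‖) ^ 4 * Real.exp (1 + ‖z‖)) := by ring
            _ ≤ K * (24 * Real.exp 6 * Real.exp (‖z‖ ^ 2 / 4)) := by
                exact mul_le_mul_of_nonneg_left (pow_four_mul_exp_le (norm_nonneg z)) hK
            _ = _ := by ring
      _ = c₁ * K := by rw [integral_const_mul]; ring
      -- For `K ≤ 1` the mass is at least `exp(-m)`, so an absolute bound is also a relative one.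
      _ ≤ c₁ * K * (Real.exp m * M) := by
          refine le_mul_of_one_le_right (by positivity) ?_
          calc (1 : ℝ) = Real.exp m * Real.exp (-m) := by rw [← Real.exp_add]; simp
            _ ≤ Real.exp m * M := by
                gcongr
                refine le_trans ?_ hMlow
                gcongr
                nlinarith
      _ = c₁ * Real.exp m * K * M := by ring
      _ ≤ c * K * M := by gcongr; linarith

variable {V : Type*} [NormedAddCommGroup V] [NormedSpace ℝ V]

/-- The mean-zero weight annihilates the constant `y`, which leaves only the increment `f`. -/
lemma norm_integral_smul_le_of_integral_eq_zero
    (hI : Integrable (fun z : E => Real.exp (‖z‖ ^ 2 / 4)) μ) {c K a : ℝ} (ha : 0 ≤ a)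
    {f : E → ℝ} (hf : Measurable f) (hfK : ∀ z, |f z| ≤ K * (1 + ‖z‖))
    {p : E → V} (hp : AEStronglyMeasurable p μ) (hpa : ∀ z, ‖p z‖ ≤ a * (1 + ‖z‖) ^ 3)
    (hp0 : ∫ z, p z ∂μ = 0) (hc : ∫ z, (1 + ‖z‖) ^ 3 * |f z| ∂μ ≤ c * K) (y : ℝ) :
    ‖∫ z, (y + f z) • p z ∂μ‖ ≤ a * (c * K) := by
  have hint : Integrable (fun z => (1 + ‖z‖) ^ 3 * |f z|) μ := by
    refine ((integrable_pow_le hI le_rfl).const_mul K).mono'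
      (Measurable.aestronglyMeasurable (by fun_prop)) (ae_of_all _ fun z => ?_)
    rw [Real.norm_of_nonneg (by positivity)]
    calc (1 + ‖z‖) ^ 3 * |f z| ≤ (1 + ‖z‖) ^ 3 * (K * (1 + ‖z‖)) := by gcongr; exact hfK z
      _ = _ := by ring
  have hpi : Integrable p μ := ((integrable_pow_le hI (n := 3) (by norm_num)).const_mul a).mono' hp
    (ae_of_all _ hpa)
  have hb : ∀ z, ‖f z • p z‖ ≤ a * ((1 + ‖z‖) ^ 3 * |f z|) := fun z => by
    rw [norm_smul, Real.norm_eq_abs]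
    calc |f z| * ‖p z‖ ≤ |f z| * (a * (1 + ‖z‖) ^ 3) := by gcongr; exact hpa z
      _ = _ := by ring
  have hfp : Integrable (fun z => f z • p z) μ :=
    (hint.const_mul a).mono' (hf.aestronglyMeasurable.smul hp) (ae_of_all _ hb)
  have e : ∫ z, (y + f z) • p z ∂μ = ∫ z, f z • p z ∂μ := by
    have h : ∫ z, (y • p z + f z • p z) ∂μ = (∫ z, y • p z ∂μ) + ∫ z, f z • p z ∂μ :=
      integral_add (hpi.smul y) hfp
    simp only [add_smul]
    rw [h, integral_smul, hp0, smul_zero, zero_add]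
  rw [e]
  calc ‖∫ z, f z • p z ∂μ‖ ≤ ∫ z, a * ((1 + ‖z‖) ^ 3 * |f z|) ∂μ :=
        norm_integral_le_of_norm_le (hint.const_mul a) (ae_of_all _ hb)
    _ = a * ∫ z, (1 + ‖z‖) ^ 3 * |f z| ∂μ := integral_const_mul _ _
    _ ≤ _ := by gcongr

/-- For `K ≤ 1` the mean-zero weight allows `exp(-f)` to be replaced by `exp(-f) - 1`, which is of
order `K`. For `K ≥ 1` the factor `K` costs nothing and the plain tilt bound suffices. -/
lemma norm_integral_exp_neg_smul_le_of_integral_eq_zero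
    (hI : Integrable (fun z : E => Real.exp (‖z‖ ^ 2 / 4)) μ) {c K a : ℝ} (ha : 0 ≤ a)
    (hc0 : 0 ≤ c) (hK : 0 ≤ K)
    {f : E → ℝ} (hf : Measurable f) (hfK : ∀ z, |f z| ≤ K * (1 + ‖z‖))
    {p : E → V} (hp : AEStronglyMeasurable p μ) (hpa : ∀ z, ‖p z‖ ≤ a * (1 + ‖z‖) ^ 3)
    (hp0 : ∫ z, p z ∂μ = 0)
    (hc : ∫ z, (1 + ‖z‖) ^ 3 * Real.exp (-f z) ∂μ
      ≤ c * (1 + K) ^ 3 * ∫ z, Real.exp (-f z) ∂μ)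
    (hc1 : K ≤ 1 → ∫ z, (1 + ‖z‖) ^ 3 * |Real.exp (-f z) - 1| ∂μ
        ≤ c * K * ∫ z, Real.exp (-f z) ∂μ) :
    ‖∫ z, Real.exp (-f z) • p z ∂μ‖ ≤ a * (c * K * (1 + K) ^ 3) * ∫ z, Real.exp (-f z) ∂μ := by
  have hint := integrable_pow_three_mul_exp_neg hI hf hfK
  have hw3 := integrable_pow_le hI (n := 3) (by norm_num)
  have hpi : Integrable p μ := (hw3.const_mul a).mono' hp (ae_of_all _ hpa)
  have hM : 0 ≤ ∫ z, Real.exp (-f z) ∂μ := integral_nonneg fun z => by positivity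
  have hb : ∀ (y : ℝ) z, ‖y • p z‖ ≤ a * ((1 + ‖z‖) ^ 3 * |y|) := fun y z => by
    rw [norm_smul, Real.norm_eq_abs]
    calc |y| * ‖p z‖ ≤ |y| * (a * (1 + ‖z‖) ^ 3) := by gcongr; exact hpa z
      _ = _ := by ring
  have hb' : ∀ z, ‖Real.exp (-f z) • p z‖ ≤ a * ((1 + ‖z‖) ^ 3 * Real.exp (-f z)) := fun z => by
    simpa using hb (Real.exp (-f z)) z
  have hme : AEStronglyMeasurable (fun z => Real.exp (-f z)) μ :=
    Measurable.aestronglyMeasurable (by fun_prop)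
  rcases le_total K 1 with hK1 | hK1
  · have hint1 : Integrable (fun z => (1 + ‖z‖) ^ 3 * |Real.exp (-f z) - 1|) μ := by
      refine (hint.add hw3).mono' (Measurable.aestronglyMeasurable (by fun_prop))
        (ae_of_all _ fun z => ?_)
      rw [Real.norm_of_nonneg (by positivity)]
      have : |Real.exp (-f z) - 1| ≤ Real.exp (-f z) + 1 := by
        rw [abs_le]; constructor <;> linarith [Real.exp_pos (-f z)]
      calc (1 + ‖z‖) ^ 3 * |Real.exp (-f z) - 1| ≤ (1 + ‖z‖) ^ 3 * (Real.exp (-f z) + 1) := by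
            gcongr
        _ = _ := by simp only [Pi.add_apply]; ring
    have e : ∫ z, Real.exp (-f z) • p z ∂μ = ∫ z, (Real.exp (-f z) - 1) • p z ∂μ := by
      have h : ∫ z, (Real.exp (-f z) • p z - p z) ∂μ
          = (∫ z, Real.exp (-f z) • p z ∂μ) - ∫ z, p z ∂μ :=
        integral_sub ((hint.const_mul a).mono' (hme.smul hp) (ae_of_all _ hb')) hpi
      simp only [sub_smul, one_smul]
      rw [h, hp0, sub_zero]
    rw [e]
    calc _ ≤ ∫ z, a * ((1 + ‖z‖) ^ 3 * |Real.exp (-f z) - 1|) ∂μ :=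
          norm_integral_le_of_norm_le (hint1.const_mul a) (ae_of_all _ fun z => hb _ z)
      _ = a * ∫ z, (1 + ‖z‖) ^ 3 * |Real.exp (-f z) - 1| ∂μ := integral_const_mul _ _
      _ ≤ a * (c * K * 1 * ∫ z, Real.exp (-f z) ∂μ) := by
          rw [mul_one]; gcongr; exact hc1 hK1
      _ ≤ a * (c * K * (1 + K) ^ 3 * ∫ z, Real.exp (-f z) ∂μ) := by
          gcongr; exact one_le_pow₀ (by linarith)
      _ = _ := by ring
  · calc _ ≤ ∫ z, a * ((1 + ‖z‖) ^ 3 * Real.exp (-f z)) ∂μ :=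
          norm_integral_le_of_norm_le (hint.const_mul a) (ae_of_all _ hb')
      _ = a * ∫ z, (1 + ‖z‖) ^ 3 * Real.exp (-f z) ∂μ := integral_const_mul _ _
      _ ≤ a * (c * 1 * (1 + K) ^ 3 * ∫ z, Real.exp (-f z) ∂μ) := by
          rw [mul_one]; gcongr
      _ ≤ a * (c * K * (1 + K) ^ 3 * ∫ z, Real.exp (-f z) ∂μ) := by
          gcongr
      _ = _ := by ring

end Tilt

/-! ### Standard Gaussian coordinates and the mean-zero weights. -/

section StdMeasure

variable {d : ℕ} {V : Type*} [NormedAddCommGroup V] [NormedSpace ℝ V]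

lemma measurable_ofReal_gaussianDensity (d : ℕ) :
    Measurable fun x => ENNReal.ofReal (gaussianDensity d 1 x) :=
  (continuous_gaussianDensity d 1).measurable.ennreal_ofReal

lemma integral_stdMeasure (g : EuclideanSpace ℝ (Fin d) → V) :
    ∫ z, g z ∂(stdMeasure d) = ∫ z, gaussianDensity d 1 z • g z := by
  rw [stdMeasure, integral_withDensity_eq_integral_toReal_smul (measurable_ofReal_gaussianDensity d)
    (ae_of_all _ fun _ => ENNReal.ofReal_lt_top)]
  simp only [ENNReal.toReal_ofReal (gaussianDensity_nonneg one_pos _)]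

lemma integral_gaussianDensity_one (d : ℕ) : ∫ x, gaussianDensity d 1 x = 1 := by
  have h := GaussianFourier.integral_rexp_neg_mul_sq_norm (V := EuclideanSpace ℝ (Fin d))
    (b := 1 / 2) (by norm_num)
  have e : ∀ x : EuclideanSpace ℝ (Fin d), gaussianDensity d 1 x
      = (2 * Real.pi) ^ (-(d : ℝ) / 2) * Real.exp (-(1 / 2) * ‖x‖ ^ 2) := fun x => by
    unfold gaussianDensity; ring_nf
  simp only [e]
  rw [integral_const_mul, h, finrank_euclideanSpace_fin, neg_div,
    Real.rpow_neg (by positivity), show Real.pi / (1 / 2) = 2 * Real.pi by ring]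
  exact inv_mul_cancel₀ (by positivity)

lemma integrable_gaussianDensity_one (d : ℕ) : Integrable (gaussianDensity d 1) := by
  by_contra h
  exact zero_ne_one ((integral_undef h).symm.trans (integral_gaussianDensity_one d))

instance (d : ℕ) : IsProbabilityMeasure (stdMeasure d) := by
  constructor
  rw [stdMeasure, withDensity_apply _ MeasurableSet.univ, Measure.restrict_univ,
    ← ofReal_integral_eq_lintegral_ofReal (integrable_gaussianDensity_one d)
      (ae_of_all _ fun x => gaussianDensity_nonneg one_pos x),
    integral_gaussianDensity_one, ENNReal.ofReal_one]

lemma integrable_exp_sq_div_four_stdMeasure (d : ℕ) :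
    Integrable (fun z => Real.exp (‖z‖ ^ 2 / 4)) (stdMeasure d) := by
  rw [stdMeasure, integrable_withDensity_iff_integrable_smul' (measurable_ofReal_gaussianDensity d)
    (ae_of_all _ fun _ => ENNReal.ofReal_lt_top)]
  simp only [ENNReal.toReal_ofReal (gaussianDensity_nonneg one_pos _)]
  refine ((integrable_exp_neg_mul_sq_norm (d := d) (b := 1 / 4) (by norm_num)).const_mul
    ((2 * Real.pi * 1) ^ (-(d : ℝ) / 2))).congr (ae_of_all _ fun z => ?_)
  simp only [gaussianDensity, smul_eq_mul]
  rw [mul_assoc (_ ^ _), ← Real.exp_add]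
  ring_nf

lemma gaussianDensity_one_eq {γ : ℝ} (hγ : 0 < γ) (z : EuclideanSpace ℝ (Fin d)) :
    gaussianDensity d 1 z = √γ ^ d * gaussianDensity d γ (√γ • z) := by
  have hs : √γ ^ d = γ ^ ((d : ℝ) / 2) := by
    rw [Real.sqrt_eq_rpow, ← Real.rpow_natCast, ← Real.rpow_mul hγ.le]; ring_nf
  have h1 : -‖√γ • z‖ ^ 2 / (2 * γ) = -‖z‖ ^ 2 / (2 * 1) := by
    rw [norm_smul, mul_pow, Real.norm_of_nonneg (Real.sqrt_nonneg γ), Real.sq_sqrt hγ.le]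
    field_simp
  have h2 : γ ^ ((d : ℝ) / 2) * γ ^ (-(d : ℝ) / 2) = 1 := by
    rw [← Real.rpow_add hγ]; ring_nf; exact Real.rpow_zero γ
  unfold gaussianDensity
  rw [h1, hs, Real.mul_rpow (x := 2 * Real.pi) (y := γ) (by positivity) hγ.le, mul_one]
  linear_combination (-(2 * Real.pi) ^ (-(d : ℝ) / 2) * Real.exp (-‖z‖ ^ 2 / (2 * 1))) * h2

/-- The Gaussian integral of `w` in standardised coordinates, weighted by `p`. -/
def scaled (w : EuclideanSpace ℝ (Fin d) → ℝ) (p : EuclideanSpace ℝ (Fin d) → V)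
    (γ : ℝ) (θ : EuclideanSpace ℝ (Fin d)) : V :=
  ∫ z, w (θ + √γ • z) • p z ∂(stdMeasure d)

/-- The substitution `x = θ + √γ z`. The scalar `c` collects the power of `γ` that the homogeneity
of the weight produces. -/
lemma smooth_eq_smul_scaled (w : EuclideanSpace ℝ (Fin d) → ℝ)
    {p q : EuclideanSpace ℝ (Fin d) → V} {γ c : ℝ} (hγ : 0 < γ)
    (h : ∀ z, p (√γ • z) = c • q z) (θ : EuclideanSpace ℝ (Fin d)) :
    smooth w p γ θ = c • scaled w q γ θ := by
  have hs : 0 < √γ := Real.sqrt_pos.2 hγ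
  rw [scaled, ← integral_smul, integral_stdMeasure]
  have e : ∀ z, gaussianDensity d 1 z • c • w (θ + √γ • z) • q z = √γ ^ d •
      (fun y => (w (θ + y) * gaussianDensity d γ y) • p y) (√γ • z) := fun z => by
    simp only [h, gaussianDensity_one_eq hγ z]
    module
  simp only [e]
  rw [integral_smul, Measure.integral_comp_smul volume
    (fun y => (w (θ + y) * gaussianDensity d γ y) • p y), finrank_euclideanSpace_fin, smul_smul,
    abs_of_pos (by positivity), mul_inv_cancel₀ (by positivity), one_smul, smooth,
    ← integral_sub_right_eq_self (fun y => (w (θ + y) * gaussianDensity d γ y) • p y) θ]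
  simp only [add_sub_cancel]

lemma scaled_one_left (p : EuclideanSpace ℝ (Fin d) → V) (γ : ℝ) (θ : EuclideanSpace ℝ (Fin d)) :
    scaled (fun _ => 1) p γ θ = ∫ z, p z ∂(stdMeasure d) := by
  simp [scaled]

lemma expGrowth_one : ExpGrowth (fun _ : EuclideanSpace ℝ (Fin d) => (1 : ℝ)) :=
  ⟨measurable_const, 1, 0, by norm_num, le_rfl, fun x => by simp⟩

lemma integral_id_stdMeasure (d : ℕ) : ∫ z, z ∂(stdMeasure d) = 0 := by
  rw [integral_stdMeasure]
  have h := integral_neg_eq_self (fun z : EuclideanSpace ℝ (Fin d) => gaussianDensity d 1 z • z)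
    volume
  have e : ∀ z : EuclideanSpace ℝ (Fin d), gaussianDensity d 1 (-z) • (-z)
      = -(gaussianDensity d 1 z • z) := fun z => by simp [gaussianDensity]
  simp only [e] at h
  rw [integral_neg] at h
  have h2 : (2 : ℝ) • ∫ z : EuclideanSpace ℝ (Fin d), gaussianDensity d 1 z • z = 0 := by
    rw [two_smul]
    nth_rewrite 1 [← h]
    exact neg_add_cancel _
  exact (smul_eq_zero.1 h2).resolve_left two_ne_zero

/-- The integral is the `θ`-derivative of the smoothing of the constant function `1`, which does not
depend on `θ`. -/
lemma integral_derivWeight_stdMeasure [CompleteSpace V] (a : V)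
    (T : EuclideanSpace ℝ (Fin d) →L[ℝ] V) :
    ∫ z, derivWeight 1 a T z ∂(stdMeasure d) = 0 := by
  have h := expGrowth_one.hasFDerivAt_smooth a T one_pos (0 : EuclideanSpace ℝ (Fin d))
  have e1 : smooth (fun _ => (1 : ℝ)) (fun y => a + T y) 1
      = fun _ => ∫ z, (a + T z) ∂(stdMeasure d) := by
    funext θ
    rw [smooth_eq_smul_scaled (c := 1) (q := fun y => a + T y) _ one_pos (by simp),
      scaled_one_left, one_smul]
  rw [e1] at h
  have h2 := h.unique (hasFDerivAt_const _ _)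
  rwa [smooth_eq_smul_scaled (c := 1) (q := derivWeight 1 a T) _ one_pos (by simp),
    scaled_one_left, one_smul] at h2

/-- The weight which represents the derivative in `γ`. -/
def laplaceWeight (z : EuclideanSpace ℝ (Fin d)) : ℝ := ‖z‖ ^ 2 / 2 - d / 2

lemma continuous_laplaceWeight : Continuous (laplaceWeight (d := d)) := by
  unfold laplaceWeight; fun_prop

lemma laplaceWeight_smul {γ : ℝ} (hγ : 0 < γ) (z : EuclideanSpace ℝ (Fin d)) :
    ‖√γ • z‖ ^ 2 / (2 * γ ^ 2) - d / (2 * γ) = γ⁻¹ * laplaceWeight z := by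
  rw [norm_smul, mul_pow, Real.norm_of_nonneg (Real.sqrt_nonneg γ), Real.sq_sqrt hγ.le,
    laplaceWeight]
  field_simp

lemma abs_laplaceWeight_le (z : EuclideanSpace ℝ (Fin d)) :
    |laplaceWeight z| ≤ (1 + d) * (1 + ‖z‖) ^ 2 := by
  have hz := norm_nonneg z
  have hd : (0 : ℝ) ≤ d := Nat.cast_nonneg d
  have h1 : (1 : ℝ) ≤ (1 + ‖z‖) ^ 2 := one_le_pow₀ (by linarith)
  have h2 : ‖z‖ ^ 2 ≤ (1 + ‖z‖) ^ 2 := by gcongr; linarith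
  have h3 : (d : ℝ) * 1 ≤ d * (1 + ‖z‖) ^ 2 := by gcongr
  rw [laplaceWeight, abs_le]
  constructor <;> nlinarith

lemma norm_laplaceWeight_smul_le (z : EuclideanSpace ℝ (Fin d)) :
    ‖laplaceWeight z • z‖ ≤ (1 + d) * (1 + ‖z‖) ^ 3 := by
  rw [norm_smul, Real.norm_eq_abs]
  calc |laplaceWeight z| * ‖z‖ ≤ ((1 + d) * (1 + ‖z‖) ^ 2) * (1 + ‖z‖) := by
        gcongr
        · exact abs_laplaceWeight_le z
        · linarith
    _ = _ := by ring

lemma one_add_norm_le_pow_three (z : EuclideanSpace ℝ (Fin d)) : 1 + ‖z‖ ≤ (1 + ‖z‖) ^ 3 :=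
  le_self_pow₀ (by linarith [norm_nonneg z]) (by norm_num)

lemma ExpGrowth.hasDerivAt_smooth_eq_scaled [CompleteSpace V]
    {w : EuclideanSpace ℝ (Fin d) → ℝ} (hw : ExpGrowth w) {p : EuclideanSpace ℝ (Fin d) → V}
    (hp : Continuous p) {a : ℝ} (ha : 0 ≤ a) (hpa : ∀ y, ‖p y‖ ≤ a * (1 + ‖y‖)) {γ c : ℝ}
    (hγ : 0 < γ) (hc : ∀ z, p (√γ • z) = c • p z) (θ : EuclideanSpace ℝ (Fin d)) :
    HasDerivAt (fun γ => smooth w p γ θ)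
      ((γ⁻¹ * c) • scaled w (fun z => laplaceWeight z • p z) γ θ) γ := by
  refine (hw.hasDerivAt_smooth hp ha hpa hγ θ).congr_deriv ?_
  refine smooth_eq_smul_scaled w hγ (fun z => ?_) θ
  rw [laplaceWeight_smul hγ, hc]
  module

/-- The integral is the `γ`-derivative at `1` of the smoothing of the constant function `1`, which
`hv` makes independent of `γ`. -/
lemma integral_laplaceWeight_smul_stdMeasure [CompleteSpace V] {p : EuclideanSpace ℝ (Fin d) → V}
    (hp : Continuous p) {a : ℝ} (ha : 0 ≤ a) (hpa : ∀ y, ‖p y‖ ≤ a * (1 + ‖y‖))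
    {v : V} (hv : ∀ γ : ℝ, 0 < γ → smooth (fun _ => (1 : ℝ)) p γ 0 = v) :
    ∫ z, laplaceWeight z • p z ∂(stdMeasure d) = 0 := by
  have h := expGrowth_one.hasDerivAt_smooth_eq_scaled hp ha hpa (c := 1) one_pos (by simp) 0
  have h0 : HasDerivAt (fun γ => smooth (fun _ => (1 : ℝ)) p γ 0) 0 1 := by
    refine (hasDerivAt_const 1 v).congr_of_eventuallyEq ?_
    filter_upwards [Ioi_mem_nhds one_pos] with γ hγ using hv γ hγ
  have := h.unique h0
  rwa [scaled_one_left, inv_one, one_mul, one_smul] at this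

lemma integral_laplaceWeight_stdMeasure (d : ℕ) :
    ∫ z, laplaceWeight z ∂(stdMeasure d) = 0 := by
  have := integral_laplaceWeight_smul_stdMeasure (d := d) (p := fun _ => (1 : ℝ)) (a := 1)
    continuous_const zero_le_one (fun y => by simp) (v := 1) (fun γ hγ => by
      rw [smooth_eq_smul_scaled (c := 1) (q := fun _ => (1 : ℝ)) _ hγ (by simp), scaled_one_left]
      simp)
  simpa using this

lemma integral_laplaceWeight_smul_id_stdMeasure (d : ℕ) :
    ∫ z, laplaceWeight z • z ∂(stdMeasure d) = 0 :=
  integral_laplaceWeight_smul_stdMeasure (d := d) (p := fun z => z) (a := 1)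
    continuous_id zero_le_one (fun y => by simp) (v := 0) (fun γ hγ => by
      rw [smooth_eq_smul_scaled (c := √γ) (q := fun z => z) _ hγ (by simp), scaled_one_left,
        integral_id_stdMeasure, smul_zero])

end StdMeasure

/-! ### Derivatives of the mass and of its gradient as rescaled weighted integrals. -/

section Derivatives

variable {d : ℕ} {w : EuclideanSpace ℝ (Fin d) → ℝ}

/-- The total mass of `w` against the Gaussian distribution `N_d(θ, γ I)`. -/
def mass (w : EuclideanSpace ℝ (Fin d) → ℝ) (γ : ℝ) (θ : EuclideanSpace ℝ (Fin d)) : ℝ :=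
  smooth w (fun _ => (1 : ℝ)) γ θ

/-- The gradient of `mass w γ`. -/
def massGrad (w : EuclideanSpace ℝ (Fin d) → ℝ) (γ : ℝ) (θ : EuclideanSpace ℝ (Fin d)) :
    EuclideanSpace ℝ (Fin d) :=
  γ⁻¹ • smooth w (fun y => y) γ θ

lemma mass_eq_integral (w : EuclideanSpace ℝ (Fin d) → ℝ) (γ : ℝ)
    (θ : EuclideanSpace ℝ (Fin d)) :
    mass w γ θ = ∫ x, w x * gaussianDensity d γ (x - θ) := by
  simp [mass, smooth]

lemma mass_eq_scaled (w : EuclideanSpace ℝ (Fin d) → ℝ) {γ : ℝ} (hγ : 0 < γ)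
    (θ : EuclideanSpace ℝ (Fin d)) :
    mass w γ θ = ∫ z, w (θ + √γ • z) ∂(stdMeasure d) := by
  rw [mass, smooth_eq_smul_scaled (c := 1) (q := fun _ => (1 : ℝ)) w hγ (by simp) θ]
  simp [scaled]

lemma massGrad_eq_scaled (w : EuclideanSpace ℝ (Fin d) → ℝ) {γ : ℝ} (hγ : 0 < γ)
    (θ : EuclideanSpace ℝ (Fin d)) :
    massGrad w γ θ = (√γ)⁻¹ • scaled w (fun z => z) γ θ := by
  have hs : 0 < √γ := Real.sqrt_pos.2 hγ
  rw [massGrad, smooth_eq_smul_scaled (c := √γ) (q := fun z => z) w hγ (by simp) θ, smul_smul]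
  congr 1
  field_simp
  exact Real.sq_sqrt hγ.le

/-- The second derivative weight `z ↦ z ⊗ z - 1`. -/
abbrev hessWeight (z : EuclideanSpace ℝ (Fin d)) :
    EuclideanSpace ℝ (Fin d) →L[ℝ] EuclideanSpace ℝ (Fin d) :=
  derivWeight 1 0 (ContinuousLinearMap.id ℝ _) z

lemma norm_hessWeight_le (z : EuclideanSpace ℝ (Fin d)) :
    ‖hessWeight z‖ ≤ 2 * (1 + ‖z‖) ^ 3 := by
  refine (norm_derivWeight_le one_pos _ _ z).trans ?_
  have := ContinuousLinearMap.norm_id_le (𝕜 := ℝ) (E := EuclideanSpace ℝ (Fin d))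
  gcongr
  simp only [inv_one, norm_zero]
  linarith

lemma ExpGrowth.hasGradientAt_mass (hw : ExpGrowth w) {γ : ℝ} (hγ : 0 < γ)
    (θ : EuclideanSpace ℝ (Fin d)) : HasGradientAt (mass w γ) (massGrad w γ θ) θ := by
  rw [hasGradientAt_iff_hasFDerivAt]
  have h := hw.hasFDerivAt_smooth (1 : ℝ) 0 hγ θ
  have e : (fun y => (1 : ℝ) + (0 : EuclideanSpace ℝ (Fin d) →L[ℝ] ℝ) y) = fun _ => 1 := by
    funext y; simp
  rw [e] at h
  refine h.congr_fderiv ?_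
  have hi : Integrable (fun x => (w x * gaussianDensity d γ (x - θ)) • (x - θ)) :=
    hw.integrable_smul (p := fun y => y) continuous_id zero_le_one
      (fun y => by linarith [one_add_norm_le_pow_three y]) hγ θ
  have hc := (InnerProductSpace.toDual ℝ (EuclideanSpace ℝ (Fin d))).toContinuousLinearEquiv
    |>.toContinuousLinearMap.integral_comp_comm hi
  have e2 : InnerProductSpace.toDual ℝ (EuclideanSpace ℝ (Fin d)) (massGrad w γ θ)
      = γ⁻¹ • ∫ x, InnerProductSpace.toDual ℝ (EuclideanSpace ℝ (Fin d))
        ((w x * gaussianDensity d γ (x - θ)) • (x - θ)) := by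
    rw [massGrad, map_smulₛₗ]
    exact congrArg _ hc.symm
  rw [e2, ← integral_smul, smooth]
  congr 1
  funext x
  ext y
  simp [derivWeight]
  ring

lemma ExpGrowth.hasFDerivAt_massGrad (hw : ExpGrowth w) {γ : ℝ} (hγ : 0 < γ)
    (θ : EuclideanSpace ℝ (Fin d)) :
    HasFDerivAt (massGrad w γ) (γ⁻¹ • scaled w hessWeight γ θ) θ := by
  have h := (hw.hasFDerivAt_smooth 0 (ContinuousLinearMap.id ℝ _) hγ θ).const_smul γ⁻¹
  have e : (fun y => 0 + (ContinuousLinearMap.id ℝ (EuclideanSpace ℝ (Fin d))) y)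
      = fun y => y := by funext y; simp
  rw [e] at h
  refine h.congr_fderiv ?_
  rw [smooth_eq_smul_scaled (c := 1) (q := hessWeight) w hγ (fun z => ?_) θ, one_smul]
  ext1 y
  simp only [derivWeight, map_smul, sub_apply, smul_apply, ContinuousLinearMap.smulRight_apply,
    ContinuousLinearMap.id_apply, zero_add, inv_one, one_smul, smul_eq_mul, smul_smul]
  congr 2
  have := Real.mul_self_sqrt hγ.le
  field_simp
  rw [Real.sq_sqrt hγ.le]

lemma ExpGrowth.hasDerivAt_mass (hw : ExpGrowth w) {γ : ℝ} (hγ : 0 < γ)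
    (θ : EuclideanSpace ℝ (Fin d)) :
    HasDerivAt (fun γ => mass w γ θ) (γ⁻¹ * scaled w laplaceWeight γ θ) γ := by
  have h := hw.hasDerivAt_smooth_eq_scaled (p := fun _ => (1 : ℝ)) (a := 1) (c := 1)
    continuous_const zero_le_one (fun y => by simp) hγ (by simp) θ
  refine h.congr_deriv ?_
  simp

/-- The subtracted integral comes from differentiating the prefactor `γ⁻¹` of the gradient. -/
lemma ExpGrowth.hasDerivAt_massGrad (hw : ExpGrowth w) {γ : ℝ} (hγ : 0 < γ)
    (θ : EuclideanSpace ℝ (Fin d)) :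
    HasDerivAt (fun γ => massGrad w γ θ) ((γ⁻¹ * (√γ)⁻¹) •
      (scaled w (fun z => laplaceWeight z • z) γ θ - scaled w (fun z => z) γ θ)) γ := by
  have hs : 0 < √γ := Real.sqrt_pos.2 hγ
  have hsq := Real.sq_sqrt hγ.le
  have h := hw.hasDerivAt_smooth_eq_scaled (p := fun z => z) (a := 1) (c := √γ)
    continuous_id zero_le_one (fun y => by simp) hγ (by simp) θ
  refine ((hasDerivAt_inv hγ.ne').smul h).congr_deriv ?_
  rw [smooth_eq_smul_scaled (c := √γ) (q := fun z => z) w hγ (by simp) θ, smul_sub, smul_smul,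
    smul_smul, sub_eq_add_neg, ← neg_smul]
  congr 2
  · field_simp
    rw [hsq]
  · field_simp
    rw [hsq]

end Derivatives

/-! ### Linear growth from the Hölder condition. -/

section Holder

variable {d : ℕ}

/-- Chaining: a function that is Hölder at small scales grows at most linearly. -/
lemma abs_sub_le_of_holder {g : EuclideanSpace ℝ (Fin d) → ℝ} {j α β : ℝ} (hj : 0 ≤ j)
    (hα : 0 ≤ α) (hαβ : α ≤ β)
    (h : ∀ θ θ', |g θ - g θ'| ≤ j * (‖θ - θ'‖ ^ α + ‖θ - θ'‖ ^ β)) {s : ℝ} (hs : 0 < s)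
    (hs1 : s ≤ 1) (θ z : EuclideanSpace ℝ (Fin d)) :
    |g (θ + s • z) - g θ| ≤ 2 * j * s ^ α * (1 + ‖z‖) := by
  have hsα : 0 ≤ s ^ α := Real.rpow_nonneg hs.le _
  -- For steps of length at most `s ≤ 1`, the power with exponent `β ≥ α` is also at most `s ^ α`.
  have step : ∀ x v, ‖v‖ ≤ s → |g (x + v) - g x| ≤ 2 * j * s ^ α := fun x v hv => by
    refine (h _ _).trans ?_
    rw [add_sub_cancel_left]
    have h1 : ‖v‖ ^ α ≤ s ^ α := Real.rpow_le_rpow (norm_nonneg _) hv hα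
    have h2 : ‖v‖ ^ β ≤ s ^ α := (Real.rpow_le_rpow (norm_nonneg _) hv (hα.trans hαβ)).trans
      (Real.rpow_le_rpow_of_exponent_ge hs hs1 hαβ)
    nlinarith
  have chain : ∀ (n : ℕ) v, ‖v‖ ≤ s → |g (θ + (n : ℝ) • v) - g θ| ≤ n * (2 * j * s ^ α) := by
    intro n v hv
    induction n with
    | zero => simp
    | succ n ih =>
      have e : θ + ((n + 1 : ℕ) : ℝ) • v = (θ + (n : ℝ) • v) + v := by
        push_cast; module
      rw [e]
      calc _ ≤ |g (θ + (n : ℝ) • v + v) - g (θ + (n : ℝ) • v)| + |g (θ + (n : ℝ) • v) - g θ| :=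
            abs_sub_le _ _ _
        _ ≤ 2 * j * s ^ α + n * (2 * j * s ^ α) := add_le_add (step _ _ hv) ih
        _ = _ := by push_cast; ring
  -- The case `z = 0` is separate because the number of steps `⌈‖z‖⌉₊`, by which the path is
  -- divided, vanishes there.
  rcases eq_or_ne z 0 with rfl | hz
  · simp; positivity
  have hn : 0 < ⌈‖z‖⌉₊ := Nat.ceil_pos.2 (norm_pos_iff.2 hz)
  have hn' : (0 : ℝ) < ⌈‖z‖⌉₊ := Nat.cast_pos.2 hn
  have hv : ‖((⌈‖z‖⌉₊ : ℝ)⁻¹ * s) • z‖ ≤ s := by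
    rw [norm_smul, Real.norm_of_nonneg (by positivity)]
    calc (⌈‖z‖⌉₊ : ℝ)⁻¹ * s * ‖z‖ ≤ (⌈‖z‖⌉₊ : ℝ)⁻¹ * s * ⌈‖z‖⌉₊ := by
          gcongr; exact Nat.le_ceil _
      _ = s := by field_simp
  have hc := chain ⌈‖z‖⌉₊ _ hv
  rw [smul_smul, mul_inv_cancel_left₀ hn'.ne'] at hc
  refine hc.trans ?_
  rw [mul_comm]
  gcongr
  linarith [Nat.ceil_lt_add_one (norm_nonneg z)]

lemma expGrowth_of_abs_sub_le {g : EuclideanSpace ℝ (Fin d) → ℝ} (hg : Measurable g) {k : ℝ}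
    (hk : 0 ≤ k) (h : ∀ z, |g z - g 0| ≤ k * (1 + ‖z‖)) : ExpGrowth g := by
  refine ⟨hg, |g 0| + k, 1, by positivity, zero_le_one, fun x => ?_⟩
  have h1 : |g x| ≤ |g 0| + |g x - g 0| := by
    have := abs_add_le (g 0) (g x - g 0); rwa [add_sub_cancel] at this
  have h2 : 1 + ‖x‖ ≤ Real.exp (1 * ‖x‖) := by
    rw [one_mul, add_comm]; exact Real.add_one_le_exp _
  have h3 : 1 ≤ Real.exp (1 * ‖x‖) := Real.one_le_exp (by positivity)
  calc |g x| ≤ |g 0| * 1 + k * (1 + ‖x‖) := by linarith [h x]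
    _ ≤ |g 0| * Real.exp (1 * ‖x‖) + k * Real.exp (1 * ‖x‖) := by gcongr
    _ = _ := by ring

lemma expGrowth_exp_neg_of_abs_sub_le {g : EuclideanSpace ℝ (Fin d) → ℝ} (hg : Measurable g)
    {k : ℝ} (hk : 0 ≤ k) (h : ∀ z, |g z - g 0| ≤ k * (1 + ‖z‖)) :
    ExpGrowth fun x => Real.exp (-g x) := by
  refine ⟨by fun_prop, Real.exp (-g 0 + k), k, by positivity, hk, fun x => ?_⟩
  rw [abs_of_pos (Real.exp_pos _), ← Real.exp_add]
  gcongr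
  linarith [(abs_le.1 (h x)).1]

end Holder

/-! ### Polynomial moments of the Hölder constant. -/

section Moments

variable {U : Type*} [MeasurableSpace U] {P : Measure U} {J : U → ℝ}

/-- Since `1 + |z| ^ β ≥ 1`, the inner integral over a probability measure is at least `exp(υ J)`.
-/
lemma integrable_exp_mul_of_moment (hJ : Measurable J) (hJ0 : ∀ u, 0 ≤ J u) {β υ : ℝ}
    (hυ : 0 < υ)
    (hmom : ∫⁻ u, ∫⁻ z : ℝ, ENNReal.ofReal (Real.exp (υ * J u * (1 + |z| ^ β)))
      ∂(gaussianReal 0 1) ∂P < ⊤) : Integrable (fun u => Real.exp (υ * J u)) P := by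
  refine ⟨Measurable.aestronglyMeasurable (by fun_prop), ?_⟩
  rw [hasFiniteIntegral_iff_ofReal (ae_of_all _ fun u => (Real.exp_pos _).le)]
  refine lt_of_le_of_lt (lintegral_mono fun u => ?_) hmom
  calc ENNReal.ofReal (Real.exp (υ * J u))
      = ∫⁻ _ : ℝ, ENNReal.ofReal (Real.exp (υ * J u)) ∂(gaussianReal 0 1) := by simp
    _ ≤ _ := by
      refine lintegral_mono fun z => ENNReal.ofReal_le_ofReal (Real.exp_le_exp.2 ?_)
      refine le_mul_of_one_le_right (mul_nonneg hυ.le (hJ0 u)) ?_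
      linarith [Real.rpow_nonneg (abs_nonneg z) β]

lemma integrable_one_add_rpow (hJ : Measurable J) (hJ0 : ∀ u, 0 ≤ J u) {υ : ℝ} (hυ : 0 < υ)
    (h : Integrable (fun u => Real.exp (υ * J u)) P) {s : ℝ} (hs : 0 < s) :
    Integrable (fun u => (1 + J u) ^ s) P := by
  -- From `a ≥ 1` follows `1 + J ≤ a exp(J / a)`, and `s / a ≤ υ` keeps the `s`-th power below the
  -- exponential moment.
  set a := max 1 (s / υ) with ha
  have ha1 : 1 ≤ a := le_max_left _ _
  have ha0 : 0 < a := by linarith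
  refine (h.const_mul (a ^ s)).mono' (Measurable.aestronglyMeasurable (by fun_prop))
    (ae_of_all _ fun u => ?_)
  have hu := hJ0 u
  rw [Real.norm_of_nonneg (by positivity)]
  have h1 : 1 + J u ≤ a * Real.exp (J u / a) := by
    calc 1 + J u ≤ a + J u := by linarith
      _ = a * (J u / a + 1) := by rw [mul_add, mul_div_cancel₀ _ ha0.ne']; ring
      _ ≤ _ := by gcongr; exact Real.add_one_le_exp _
  calc (1 + J u) ^ s ≤ (a * Real.exp (J u / a)) ^ s := by gcongr
    _ = a ^ s * Real.exp (J u / a * s) := by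
        rw [Real.mul_rpow ha0.le (Real.exp_pos _).le, ← Real.exp_mul]
    _ ≤ a ^ s * Real.exp (υ * J u) := by
        refine mul_le_mul_of_nonneg_left (Real.exp_le_exp.2 ?_) (by positivity)
        have h2 : s ≤ υ * a := by
          have := le_max_right 1 (s / υ)
          rw [div_le_iff₀ hυ] at this
          linarith
        rw [div_mul_eq_mul_div, div_le_iff₀ ha0]
        nlinarith

end Moments

/-! ### From centred integrals to derivative bounds, and from these to (S2). -/

section Bounds

variable {d : ℕ}

/-- First and second order bounds, in `θ` and in `γ`, for a family of functions `L γ`. -/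
def HasDerivBounds (α B : ℝ) (L : ℝ → EuclideanSpace ℝ (Fin d) → ℝ) : Prop :=
  ∃ G : ℝ → EuclideanSpace ℝ (Fin d) → EuclideanSpace ℝ (Fin d), ∀ γ ∈ Ioc (0 : ℝ) 1, ∀ θ,
    (HasGradientAt (L γ) (G γ θ) θ ∧ ‖G γ θ‖ ≤ (√γ)⁻¹ * (γ ^ (α / 2) * B)) ∧
    (∃ H : EuclideanSpace ℝ (Fin d) →L[ℝ] EuclideanSpace ℝ (Fin d), HasFDerivAt (G γ) H θ ∧
      ‖H‖ ≤ γ⁻¹ * (γ ^ (α / 2) * B)) ∧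
    (∃ l, HasDerivAt (fun s => L s θ) l γ ∧ ‖l‖ ≤ γ⁻¹ * (γ ^ (α / 2) * B)) ∧
    ∃ g, HasDerivAt (fun s => G s θ) g γ ∧ ‖g‖ ≤ γ⁻¹ * (√γ)⁻¹ * (γ ^ (α / 2) * B)

lemma HasDerivBounds.mono {α B B' : ℝ} {L : ℝ → EuclideanSpace ℝ (Fin d) → ℝ}
    (h : HasDerivBounds α B L) (hB : B ≤ B') : HasDerivBounds α B' L := by
  obtain ⟨G, hG⟩ := h
  refine ⟨G, fun γ hγ θ => ?_⟩
  have h0 : 0 < γ := hγ.1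
  have h1 : γ ^ (α / 2) * B ≤ γ ^ (α / 2) * B' := by gcongr
  obtain ⟨⟨a1, a2⟩, ⟨H, b1, b2⟩, ⟨l, c1, c2⟩, ⟨g, d1, d2⟩⟩ := hG γ hγ θ
  exact ⟨⟨a1, a2.trans (by gcongr)⟩, ⟨H, b1, b2.trans (by gcongr)⟩,
    ⟨l, c1, c2.trans (by gcongr)⟩, ⟨g, d1, d2.trans (by gcongr)⟩⟩

lemma norm_sub_le_of_hasDerivAt_le {V : Type*} [NormedAddCommGroup V] [NormedSpace ℝ V]
    {F : ℝ → V} {a b M : ℝ} (hab : a ≤ b)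
    (h : ∀ s ∈ Icc a b, ∃ v, HasDerivAt F v s ∧ ‖v‖ ≤ M) : ‖F a - F b‖ ≤ M * (b - a) := by
  choose! F' hF hM using h
  rw [norm_sub_rev]
  refine ((convex_Icc a b).norm_image_sub_le_of_norm_hasDerivWithin_le
    (fun s hs => (hF s hs).hasDerivWithinAt) hM (left_mem_Icc.2 hab) (right_mem_Icc.2 hab)).trans ?_
  rw [Real.norm_of_nonneg (by linarith)]

/-- Mean value inequalities: in `θ` with the Hessian, and on `[γ', γ]` with the `γ`-derivatives,
whose powers of `s⁻¹` are largest at `γ'`. The last two bounds have slack, since `γ ^ (α / 2) ≤ 1`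
and `(γ / γ') ^ (d / 2) ≥ 1`. -/
lemma HasDerivBounds.regularity {α B : ℝ} {L : ℝ → EuclideanSpace ℝ (Fin d) → ℝ}
    (h : HasDerivBounds α B L) (hα : 0 ≤ α) (hB : 0 ≤ B) {γ' γ : ℝ} (h0 : 0 < γ') (hle : γ' ≤ γ)
    (h1 : γ ≤ 1) (θ θ' : EuclideanSpace ℝ (Fin d)) :
    Differentiable ℝ (L γ) ∧
      ‖gradient (L γ) θ‖ ≤ γ ^ ((α - 1) / 2) * B ∧
      ‖gradient (L γ) θ - gradient (L γ) θ'‖ ≤ γ ^ (-1 + α / 2) * ‖θ - θ'‖ * B ∧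
      |L γ' θ - L γ θ| ≤ (γ / γ') ^ ((d : ℝ) / 2) * ((γ - γ') / γ') * B ∧
      ‖gradient (L γ') θ - gradient (L γ) θ‖
        ≤ γ ^ ((1 : ℝ) / 2) * (γ / γ') ^ ((d : ℝ) / 2) * ((γ - γ') / γ' ^ 2) * B := by
  obtain ⟨G, hG⟩ := h
  have hγ0 : 0 < γ := h0.trans_le hle
  have hγ : γ ∈ Ioc (0 : ℝ) 1 := ⟨hγ0, h1⟩
  have hγ' : γ' ∈ Ioc (0 : ℝ) 1 := ⟨h0, hle.trans h1⟩
  have hgr : ∀ s ∈ Ioc (0 : ℝ) 1, ∀ t, gradient (L s) t = G s t := fun s hs t =>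
    (hG s hs t).1.1.gradient
  have hr : 1 ≤ (γ / γ') ^ ((d : ℝ) / 2) :=
    Real.one_le_rpow ((one_le_div h0).2 hle) (by positivity)
  have hsq : 0 < √γ' := Real.sqrt_pos.2 h0
  have hsγ : √γ' ≤ √γ := Real.sqrt_le_sqrt hle
  have hsub : ∀ s ∈ Icc γ' γ, s ∈ Ioc (0 : ℝ) 1 := fun s hs =>
    ⟨h0.trans_le hs.1, hs.2.trans h1⟩
  have hpow : ∀ s ∈ Icc γ' γ, s ^ (α / 2) * B ≤ B := fun s hs =>
    mul_le_of_le_one_left hB (Real.rpow_le_one (hsub s hs).1.le (hsub s hs).2 (by positivity))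
  refine ⟨fun t => (hG γ hγ t).1.1.hasFDerivAt.differentiableAt, ?_, ?_, ?_, ?_⟩
  · rw [hgr γ hγ]
    refine (hG γ hγ θ).1.2.trans (le_of_eq ?_)
    rw [← mul_assoc, Real.sqrt_eq_rpow, ← Real.rpow_neg hγ0.le, ← Real.rpow_add hγ0]
    congr 2
    ring
  · rw [hgr γ hγ, hgr γ hγ]
    have hH := fun t => (hG γ hγ t).2.1
    choose H hH hHb using hH
    refine (convex_univ.norm_image_sub_le_of_norm_hasFDerivWithin_le
      (fun t _ => (hH t).hasFDerivWithinAt) (fun t _ => hHb t) (mem_univ θ')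
      (mem_univ θ)).trans (le_of_eq ?_)
    rw [Real.rpow_add hγ0, Real.rpow_neg_one]
    ring
  · have := norm_sub_le_of_hasDerivAt_le (M := γ'⁻¹ * B) (F := fun s => L s θ) hle
      (fun s hs => by
        obtain ⟨l, hl, hlb⟩ := (hG s (hsub s hs) θ).2.2.1
        refine ⟨l, hl, hlb.trans ?_⟩
        have := hpow s hs
        have := hs.1
        have := (hsub s hs).1
        gcongr)
    rw [← Real.norm_eq_abs]
    refine this.trans ?_
    have h2 : 0 ≤ (γ - γ') / γ' * B := mul_nonneg (div_nonneg (by linarith) h0.le) hB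
    calc γ'⁻¹ * B * (γ - γ') = 1 * ((γ - γ') / γ' * B) := by field_simp
      _ ≤ (γ / γ') ^ ((d : ℝ) / 2) * ((γ - γ') / γ' * B) := by gcongr
      _ = _ := by ring
  · rw [hgr γ hγ, hgr γ' hγ']
    have := norm_sub_le_of_hasDerivAt_le (M := γ'⁻¹ * (√γ')⁻¹ * B) (F := fun s => G s θ) hle
      (fun s hs => by
        obtain ⟨l, hl, hlb⟩ := (hG s (hsub s hs) θ).2.2.2
        refine ⟨l, hl, hlb.trans ?_⟩
        have := hpow s hs
        have := hs.1
        have := (hsub s hs).1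
        gcongr)
    refine this.trans ?_
    have hsub0 : 0 ≤ γ - γ' := by linarith
    have h2 : 0 ≤ (γ - γ') / γ' ^ 2 * B := mul_nonneg (div_nonneg hsub0 (by positivity)) hB
    rw [← Real.sqrt_eq_rpow]
    -- The power `γ'^(-3/2)` is written as `√γ' / γ'²`, and `√γ' ≤ √γ`.
    calc γ'⁻¹ * (√γ')⁻¹ * B * (γ - γ') = √γ' * 1 * ((γ - γ') / γ' ^ 2 * B) := by
          field_simp
          rw [Real.sq_sqrt h0.le]
      _ ≤ √γ * (γ / γ') ^ ((d : ℝ) / 2) * ((γ - γ') / γ' ^ 2 * B) := by gcongr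
      _ = _ := by ring

/-- Bounds on the Gaussian integrals of `w` weighted by centred functions, relative to `N`. -/
def HasCentredBounds (α S : ℝ) (N : ℝ → EuclideanSpace ℝ (Fin d) → ℝ)
    (w : EuclideanSpace ℝ (Fin d) → ℝ) : Prop :=
  ∀ γ ∈ Ioc (0 : ℝ) 1, ∀ θ, ∀ (V : Type) [NormedAddCommGroup V] [NormedSpace ℝ V]
    (p : EuclideanSpace ℝ (Fin d) → V) (a : ℝ), Continuous p → 0 ≤ a →
    (∀ z, ‖p z‖ ≤ a * (1 + ‖z‖) ^ 3) → ∫ z, p z ∂(stdMeasure d) = 0 →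
    ‖scaled w p γ θ‖ ≤ a * (γ ^ (α / 2) * S) * N γ θ

variable {α S : ℝ} {N : ℝ → EuclideanSpace ℝ (Fin d) → ℝ} {w : EuclideanSpace ℝ (Fin d) → ℝ}
  {γ : ℝ}

lemma HasCentredBounds.id (h : HasCentredBounds α S N w) (hγ : γ ∈ Ioc (0 : ℝ) 1)
    (θ : EuclideanSpace ℝ (Fin d)) :
    ‖scaled w (fun z => z) γ θ‖ ≤ γ ^ (α / 2) * S * N γ θ := by
  have := h γ hγ θ _ (fun z => z) 1 continuous_id zero_le_one
    (fun y => by linarith [one_add_norm_le_pow_three y]) (integral_id_stdMeasure d)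
  rwa [one_mul] at this

lemma HasCentredBounds.hessWeight (h : HasCentredBounds α S N w) (hγ : γ ∈ Ioc (0 : ℝ) 1)
    (θ : EuclideanSpace ℝ (Fin d)) :
    ‖scaled w hessWeight γ θ‖ ≤ 2 * (γ ^ (α / 2) * S) * N γ θ :=
  h γ hγ θ _ _ 2 (continuous_derivWeight _ _ _) zero_le_two norm_hessWeight_le
    (integral_derivWeight_stdMeasure _ _)

lemma HasCentredBounds.laplaceWeight (h : HasCentredBounds α S N w) (hγ : γ ∈ Ioc (0 : ℝ) 1)
    (θ : EuclideanSpace ℝ (Fin d)) :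
    ‖scaled w laplaceWeight γ θ‖ ≤ (1 + d) * (γ ^ (α / 2) * S) * N γ θ := by
  refine h γ hγ θ _ _ (1 + d) continuous_laplaceWeight (by positivity) (fun z => ?_)
    (integral_laplaceWeight_stdMeasure d)
  refine (abs_laplaceWeight_le z).trans ?_
  have := norm_nonneg z
  exact mul_le_mul_of_nonneg_left (pow_le_pow_right₀ (by linarith) (by norm_num)) (by positivity)

lemma HasCentredBounds.laplaceWeight_smul (h : HasCentredBounds α S N w)
    (hγ : γ ∈ Ioc (0 : ℝ) 1) (θ : EuclideanSpace ℝ (Fin d)) :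
    ‖scaled w (fun z => Smoothing.laplaceWeight z • z) γ θ‖
      ≤ (1 + d) * (γ ^ (α / 2) * S) * N γ θ :=
  h γ hγ θ _ _ (1 + d) (continuous_laplaceWeight.smul continuous_id) (by positivity)
    norm_laplaceWeight_smul_le (integral_laplaceWeight_smul_id_stdMeasure d)

lemma norm_smul_le_mul {V : Type*} [NormedAddCommGroup V] [NormedSpace ℝ V] {r b : ℝ} {v : V}
    (hr : 0 ≤ r) (h : ‖v‖ ≤ b) : ‖r • v‖ ≤ r * b := by
  rw [norm_smul, Real.norm_of_nonneg hr]
  gcongr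

theorem HasCentredBounds.hasDerivBounds_mass (h : HasCentredBounds α S (fun _ _ => 1) w)
    (hw : ExpGrowth w) (hS : 0 ≤ S) : HasDerivBounds α ((2 + d) * S) (mass w) := by
  refine ⟨massGrad w, fun γ hγ θ => ?_⟩
  have h0 : 0 < γ := hγ.1
  have hd : (0 : ℝ) ≤ d := Nat.cast_nonneg d
  have hT : 0 ≤ γ ^ (α / 2) * S := by positivity
  have b1 := h.id hγ θ
  have b2 := h.hessWeight hγ θ
  have b3 := h.laplaceWeight hγ θ
  have b4 := h.laplaceWeight_smul hγ θ
  rw [mul_one] at b1 b2 b3 b4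
  rw [show γ ^ (α / 2) * ((2 + d) * S) = (2 + d) * (γ ^ (α / 2) * S) by ring]
  have hdT : 0 ≤ d * (γ ^ (α / 2) * S) := by positivity
  refine ⟨⟨hw.hasGradientAt_mass h0 θ, ?_⟩, ⟨_, hw.hasFDerivAt_massGrad h0 θ, ?_⟩,
    ⟨_, hw.hasDerivAt_mass h0 θ, ?_⟩, ⟨_, hw.hasDerivAt_massGrad h0 θ, ?_⟩⟩
  · rw [massGrad_eq_scaled w h0]
    refine norm_smul_le_mul (by positivity) ?_
    linarith
  · refine norm_smul_le_mul (V := EuclideanSpace ℝ (Fin d) →L[ℝ] EuclideanSpace ℝ (Fin d)) (by positivity) ?_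
    linarith
  · rw [norm_mul, Real.norm_of_nonneg (inv_nonneg.2 h0.le)]
    gcongr
    linarith
  · refine norm_smul_le_mul (by positivity) ((norm_sub_le _ _).trans ?_)
    linarith

/-- Every derivative of the logarithm is built from integrals divided by the mass, each of size `γ ^
(α / 2) * S`. The quotient rule multiplies at most two of them, hence `S + S ^ 2`; the product has
the better factor `γ ^ α`, which is relaxed to `γ ^ (α / 2)`. -/
theorem HasCentredBounds.hasDerivBounds_neg_log_mass (h : HasCentredBounds α S (mass w) w)
    (hw : ExpGrowth w) (hα : 0 ≤ α) (hS : 0 ≤ S)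
    (hpos : ∀ γ ∈ Ioc (0 : ℝ) 1, ∀ θ, 0 < mass w γ θ) :
    HasDerivBounds α ((2 + d) * (S + S ^ 2)) (fun γ θ => -Real.log (mass w γ θ)) := by
  refine ⟨fun γ θ => -((mass w γ θ)⁻¹ • massGrad w γ θ), fun γ hγ θ => ?_⟩
  have h0 : 0 < γ := hγ.1
  have hd : (0 : ℝ) ≤ d := Nat.cast_nonneg d
  have hs : 0 < √γ := Real.sqrt_pos.2 h0
  have hM := hpos γ hγ θ
  set M := mass w γ θ with hMdef
  set T := γ ^ (α / 2) * S with hTdef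
  have hT : 0 ≤ T := by positivity
  have hTT : T * T ≤ γ ^ (α / 2) * S ^ 2 := by
    have h1 : γ ^ (α / 2) ≤ 1 := Real.rpow_le_one h0.le hγ.2 (by positivity)
    calc T * T = γ ^ (α / 2) * (γ ^ (α / 2) * S ^ 2) := by rw [hTdef]; ring
      _ ≤ γ ^ (α / 2) * (1 * S ^ 2) := by gcongr
      _ = _ := by ring
  have hfin : (2 + d) * (T + T * T) ≤ γ ^ (α / 2) * ((2 + d) * (S + S ^ 2)) := by
    calc (2 + d) * (T + T * T) ≤ (2 + d) * (T + γ ^ (α / 2) * S ^ 2) := by gcongr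
      _ = _ := by rw [hTdef]; ring
  have hTT0 : 0 ≤ T * T := by positivity
  have hdT : 0 ≤ d * T := by positivity
  have hdTT : 0 ≤ d * (T * T) := by positivity
  have hdiv : ∀ {V : Type} [NormedAddCommGroup V] [NormedSpace ℝ V] {v : V} {b : ℝ},
      ‖v‖ ≤ b * M → ‖M⁻¹ • v‖ ≤ b := fun {V} _ _ {v b} hv => by
    refine (norm_smul_le_mul (by positivity) hv).trans (le_of_eq ?_)
    field_simp
  have b1 := hdiv (h.id hγ θ)
  have b2 := hdiv (h.hessWeight hγ θ)
  have b3 := hdiv (h.laplaceWeight hγ θ)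
  have b4 := hdiv (h.laplaceWeight_smul hγ θ)
  have hG : ‖M⁻¹ • massGrad w γ θ‖ ≤ (√γ)⁻¹ * T := by
    rw [massGrad_eq_scaled w h0, smul_comm]
    exact norm_smul_le_mul (by positivity) b1
  have hγs : γ⁻¹ = (√γ)⁻¹ * (√γ)⁻¹ := by
    rw [← mul_inv, Real.mul_self_sqrt h0.le]
  refine ⟨⟨?_, ?_⟩, ?_, ?_, ?_⟩
  · have hg := (hasGradientAt_iff_hasFDerivAt.1 (hw.hasGradientAt_mass h0 θ)).log hM.ne'
    rw [hasGradientAt_iff_hasFDerivAt]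
    refine hg.neg.congr_fderiv ?_
    rw [map_neg, map_smulₛₗ]
    rfl
  · rw [norm_neg]
    refine hG.trans ?_
    gcongr
    linarith
  · have hg := (hasGradientAt_iff_hasFDerivAt.1 (hw.hasGradientAt_mass h0 θ))
    have hinv := (hasDerivAt_inv hM.ne').comp_hasFDerivAt θ hg
    have := (hinv.smul (hw.hasFDerivAt_massGrad h0 θ)).neg
    refine ⟨_, this, ?_⟩
    rw [norm_neg]
    have e1 : ‖M⁻¹ • γ⁻¹ • scaled w Smoothing.hessWeight γ θ‖ ≤ γ⁻¹ * (2 * T) := by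
      rw [smul_comm]
      exact norm_smul_le_mul (by positivity) b2
    have e2 : ‖(-(M ^ 2)⁻¹ • InnerProductSpace.toDual ℝ (EuclideanSpace ℝ (Fin d))
        (massGrad w γ θ)).smulRight (massGrad w γ θ)‖ ≤ γ⁻¹ * (T * T) := by
      rw [ContinuousLinearMap.norm_smulRight_apply, norm_smul, LinearIsometryEquiv.norm_map,
        norm_neg, Real.norm_of_nonneg (by positivity)]
      rw [norm_smul, Real.norm_of_nonneg (by positivity)] at hG
      calc (M ^ 2)⁻¹ * ‖massGrad w γ θ‖ * ‖massGrad w γ θ‖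
          = (M⁻¹ * ‖massGrad w γ θ‖) * (M⁻¹ * ‖massGrad w γ θ‖) := by ring
        _ ≤ ((√γ)⁻¹ * T) * ((√γ)⁻¹ * T) := by gcongr
        _ = γ⁻¹ * (T * T) := by rw [hγs]; ring
    refine (norm_add_le _ _).trans ((add_le_add e1 e2).trans ?_)
    rw [← mul_add]
    gcongr
    linarith
  · refine ⟨_, ((hw.hasDerivAt_mass h0 θ).log hM.ne').neg, ?_⟩
    have e : γ⁻¹ * scaled w Smoothing.laplaceWeight γ θ / mass w γ θ
        = γ⁻¹ • M⁻¹ • scaled w Smoothing.laplaceWeight γ θ := by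
      simp only [smul_eq_mul]; ring
    rw [norm_neg, e]
    refine norm_smul_le_mul (by positivity) (b3.trans ?_)
    linarith
  · have hinv := (hw.hasDerivAt_mass h0 θ).inv hM.ne'
    refine ⟨_, (hinv.smul (hw.hasDerivAt_massGrad h0 θ)).neg, ?_⟩
    rw [norm_neg]
    have e1 : ‖M⁻¹ • (γ⁻¹ * (√γ)⁻¹) • (scaled w (fun z => Smoothing.laplaceWeight z • z) γ θ
        - scaled w (fun z => z) γ θ)‖ ≤ (γ⁻¹ * (√γ)⁻¹) * ((1 + d) * T + T) := by
      rw [smul_comm, smul_sub]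
      exact norm_smul_le_mul (by positivity) ((norm_sub_le _ _).trans (add_le_add b4 b1))
    have e2 : ‖(-(γ⁻¹ * scaled w Smoothing.laplaceWeight γ θ) / M ^ 2) • massGrad w γ θ‖
        ≤ (γ⁻¹ * (√γ)⁻¹) * ((1 + d) * T * T) := by
      have e3 : (-(γ⁻¹ * scaled w Smoothing.laplaceWeight γ θ) / M ^ 2) • massGrad w γ θ
          = -(γ⁻¹ • (M⁻¹ • scaled w Smoothing.laplaceWeight γ θ) • (M⁻¹ • massGrad w γ θ)) := by
        simp only [smul_eq_mul, smul_smul, ← neg_smul]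
        congr 1
        field_simp
      rw [e3, norm_neg]
      calc _ ≤ γ⁻¹ * (((1 + d) * T) * ((√γ)⁻¹ * T)) := by
            refine norm_smul_le_mul (by positivity) ?_
            rw [norm_smul]
            gcongr
        _ = _ := by ring
    refine (norm_add_le _ _).trans ((add_le_add e1 e2).trans ?_)
    rw [← mul_add]
    gcongr
    linarith

end Bounds

/-! ### The tilt estimates applied to the increments of a single function. -/

section TiltConst

variable {d : ℕ}

/-- `c` is a valid constant in the tilt estimates for the standard Gaussian measure. -/
def IsTiltConst (d : ℕ) (c : ℝ) : Prop :=
  1 ≤ c ∧ ∀ K : ℝ, 0 ≤ K → ∀ f : EuclideanSpace ℝ (Fin d) → ℝ, Measurable f →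
    (∀ z, |f z| ≤ K * (1 + ‖z‖)) →
    ∫ z, (1 + ‖z‖) ^ 3 * |f z| ∂(stdMeasure d) ≤ c * K ∧
    Real.exp (-(c * K)) ≤ ∫ z, Real.exp (-f z) ∂(stdMeasure d) ∧
    ∫ z, Real.exp (-f z) ∂(stdMeasure d) ≤ Real.exp (c * (1 + K) ^ 2) ∧
    ∫ z, (1 + ‖z‖) ^ 3 * Real.exp (-f z) ∂(stdMeasure d)
      ≤ c * (1 + K) ^ 3 * ∫ z, Real.exp (-f z) ∂(stdMeasure d) ∧
    (K ≤ 1 → ∫ z, (1 + ‖z‖) ^ 3 * |Real.exp (-f z) - 1| ∂(stdMeasure d)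
      ≤ c * K * ∫ z, Real.exp (-f z) ∂(stdMeasure d))

lemma exists_isTiltConst (d : ℕ) : ∃ c, IsTiltConst d c :=
  exists_tilt_bounds (integrable_exp_sq_div_four_stdMeasure d)

/-- At every scale `√γ ≤ 1` the increments of `g` grow at most linearly, with a factor
of order `γ ^ (α / 2)`. -/
def HasLinearIncrements (α j : ℝ) (g : EuclideanSpace ℝ (Fin d) → ℝ) : Prop :=
  ∀ γ ∈ Ioc (0 : ℝ) 1, ∀ θ z, |g (θ + √γ • z) - g θ| ≤ 2 * j * γ ^ (α / 2) * (1 + ‖z‖)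

variable {c α j : ℝ} {g : EuclideanSpace ℝ (Fin d) → ℝ}

lemma mul_rpow_le_of_mem_Ioc (hα : 0 ≤ α) (hj : 0 ≤ j) {γ : ℝ} (hγ : γ ∈ Ioc (0 : ℝ) 1) :
    2 * j * γ ^ (α / 2) ≤ 2 * j :=
  mul_le_of_le_one_right (by positivity) (Real.rpow_le_one hγ.1.le hγ.2 (by positivity))

lemma HasLinearIncrements.hasCentredBounds (hg : Measurable g) (hj : 0 ≤ j)
    (h : HasLinearIncrements α j g) (hc : IsTiltConst d c) :
    HasCentredBounds α (c * (2 * j) * (1 + 2 * j) ^ 3) (fun _ _ => 1) g := by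
  intro γ hγ θ V _ _ p a hp ha hpa hp0
  have hγ0 : 0 < γ := hγ.1
  have hc0 : 0 ≤ c := zero_le_one.trans hc.1
  have hf : Measurable fun z => g (θ + √γ • z) - g θ := by fun_prop
  have hb := norm_integral_smul_le_of_integral_eq_zero (integrable_exp_sq_div_four_stdMeasure d)
    ha hf (h γ hγ θ) hp.aestronglyMeasurable hpa hp0
    (hc.2 _ (by positivity) _ hf (h γ hγ θ)).1 (g θ)
  simp only [add_sub_cancel] at hb
  refine hb.trans ?_
  rw [mul_one]
  -- The factor `(1 + 2 * j) ^ 3` is padding here: it gives both smoothings the same constant.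
  have h1 : (1 : ℝ) ≤ (1 + 2 * j) ^ 3 := one_le_pow₀ (by linarith)
  calc a * (c * (2 * j * γ ^ (α / 2))) = a * (γ ^ (α / 2) * (c * (2 * j) * 1)) := by ring
    _ ≤ _ := by gcongr

/-- Factoring out `exp(-g θ)` leaves a tilt by the increment. The mass has the same factor, so
relative bounds do not see the size of `g θ`. -/
lemma scaled_exp_neg_eq {V : Type*} [NormedAddCommGroup V] [NormedSpace ℝ V]
    (g : EuclideanSpace ℝ (Fin d) → ℝ) (p : EuclideanSpace ℝ (Fin d) → V) (γ : ℝ)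
    (θ : EuclideanSpace ℝ (Fin d)) :
    scaled (fun x => Real.exp (-g x)) p γ θ = Real.exp (-g θ) •
      ∫ z, Real.exp (-(g (θ + √γ • z) - g θ)) • p z ∂(stdMeasure d) := by
  rw [scaled, ← integral_smul]
  congr 1
  funext z
  rw [smul_smul, ← Real.exp_add]
  ring_nf

lemma mass_exp_neg_eq (g : EuclideanSpace ℝ (Fin d) → ℝ) {γ : ℝ} (hγ : 0 < γ)
    (θ : EuclideanSpace ℝ (Fin d)) :
    mass (fun x => Real.exp (-g x)) γ θ = Real.exp (-g θ) *
      ∫ z, Real.exp (-(g (θ + √γ • z) - g θ)) ∂(stdMeasure d) := by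
  have h := scaled_exp_neg_eq g (fun _ => (1 : ℝ)) γ θ
  simp only [scaled, smul_eq_mul, mul_one] at h
  rw [mass_eq_scaled _ hγ, h]

lemma HasLinearIncrements.hasCentredBounds_exp_neg (hg : Measurable g) (hα : 0 ≤ α)
    (hj : 0 ≤ j) (h : HasLinearIncrements α j g) (hc : IsTiltConst d c) :
    HasCentredBounds α (c * (2 * j) * (1 + 2 * j) ^ 3) (mass fun x => Real.exp (-g x))
      (fun x => Real.exp (-g x)) := by
  intro γ hγ θ V _ _ p a hp ha hpa hp0
  have hγ0 : 0 < γ := hγ.1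
  have hc0 : 0 ≤ c := zero_le_one.trans hc.1
  have hf : Measurable fun z => g (θ + √γ • z) - g θ := by fun_prop
  obtain ⟨-, -, -, h4, h5⟩ := hc.2 _ (by positivity) _ hf (h γ hγ θ)
  have hb := norm_integral_exp_neg_smul_le_of_integral_eq_zero
    (integrable_exp_sq_div_four_stdMeasure d) ha hc0 (by positivity) hf (h γ hγ θ)
    hp.aestronglyMeasurable hpa hp0 h4 h5
  have hle := mul_rpow_le_of_mem_Ioc hα hj hγ
  rw [scaled_exp_neg_eq, mass_exp_neg_eq g hγ0]
  refine (norm_smul_le_mul (Real.exp_pos _).le hb).trans ?_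
  rw [mul_left_comm]
  have hM : 0 ≤ ∫ z, Real.exp (-(g (θ + √γ • z) - g θ)) ∂(stdMeasure d) :=
    integral_nonneg fun z => (Real.exp_pos _).le
  refine mul_le_mul_of_nonneg_right (mul_le_mul_of_nonneg_left ?_ ha)
    (mul_nonneg (Real.exp_pos _).le hM)
  calc c * (2 * j * γ ^ (α / 2)) * (1 + 2 * j * γ ^ (α / 2)) ^ 3
      ≤ c * (2 * j * γ ^ (α / 2)) * (1 + 2 * j) ^ 3 := by gcongr
    _ = _ := by ring

lemma HasLinearIncrements.abs_mass_sub_le (hg : Measurable g) (hα : 0 ≤ α) (hj : 0 ≤ j)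
    (h : HasLinearIncrements α j g) (hc : IsTiltConst d c) {γ : ℝ} (hγ : γ ∈ Ioc (0 : ℝ) 1)
    (θ : EuclideanSpace ℝ (Fin d)) : |mass g γ θ - g θ| ≤ c * (1 + 2 * j) ^ 2 := by
  have hγ0 : 0 < γ := hγ.1
  have hc0 : 0 ≤ c := zero_le_one.trans hc.1
  have hI := integrable_exp_sq_div_four_stdMeasure d
  have hf : Measurable fun z => g (θ + √γ • z) - g θ := by fun_prop
  have hfi := integrable_of_abs_le hI hf (h γ hγ θ)
  have e : mass g γ θ - g θ = ∫ z, (g (θ + √γ • z) - g θ) ∂(stdMeasure d) := by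
    have hgi : Integrable (fun z => g (θ + √γ • z)) (stdMeasure d) :=
      (hfi.add (integrable_const (g θ))).congr (ae_of_all _ fun z => by simp)
    rw [mass_eq_scaled g hγ0, integral_sub hgi (integrable_const _)]
    simp
  rw [e, ← Real.norm_eq_abs]
  have hw : Integrable (fun z => (1 + ‖z‖) ^ 3 * |g (θ + √γ • z) - g θ|) (stdMeasure d) := by
    refine ((integrable_pow_le hI le_rfl).const_mul (2 * j * γ ^ (α / 2))).mono'
      (Measurable.aestronglyMeasurable (by fun_prop)) (ae_of_all _ fun z => ?_)
    rw [Real.norm_of_nonneg (by positivity)]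
    calc _ ≤ (1 + ‖z‖) ^ 3 * (2 * j * γ ^ (α / 2) * (1 + ‖z‖)) := by gcongr; exact h γ hγ θ z
      _ = _ := by ring
  -- The weight `(1 + ‖z‖) ^ 3 ≥ 1` is inserted so that the first tilt estimate applies.
  refine (norm_integral_le_of_norm_le hw (ae_of_all _ fun z => ?_)).trans ?_
  · rw [Real.norm_eq_abs]
    exact le_mul_of_one_le_left (abs_nonneg _) (one_le_pow₀ (by linarith [norm_nonneg z]))
  · refine (hc.2 _ (by positivity) _ hf (h γ hγ θ)).1.trans ?_
    have hle := mul_rpow_le_of_mem_Ioc hα hj hγ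
    gcongr
    nlinarith

lemma HasLinearIncrements.mass_exp_neg_pos (hg : Measurable g) (hj : 0 ≤ j)
    (h : HasLinearIncrements α j g) (hc : IsTiltConst d c) {γ : ℝ} (hγ : γ ∈ Ioc (0 : ℝ) 1)
    (θ : EuclideanSpace ℝ (Fin d)) : 0 < mass (fun x => Real.exp (-g x)) γ θ := by
  have hγ0 : 0 < γ := hγ.1
  have hf : Measurable fun z => g (θ + √γ • z) - g θ := by fun_prop
  rw [mass_exp_neg_eq g hγ0]
  exact mul_pos (Real.exp_pos _)
    ((Real.exp_pos _).trans_le (hc.2 _ (by positivity) _ hf (h γ hγ θ)).2.1)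

/-- The difference is `-log M` for the mass `M` of the increment tilt, and the tilt estimates bound
`M` on both sides by exponentials. -/
lemma HasLinearIncrements.abs_neg_log_mass_sub_le (hg : Measurable g) (hα : 0 ≤ α) (hj : 0 ≤ j)
    (h : HasLinearIncrements α j g) (hc : IsTiltConst d c) {γ : ℝ} (hγ : γ ∈ Ioc (0 : ℝ) 1)
    (θ : EuclideanSpace ℝ (Fin d)) :
    |-Real.log (mass (fun x => Real.exp (-g x)) γ θ) - g θ| ≤ c * (1 + 2 * j) ^ 2 := by
  have hγ0 : 0 < γ := hγ.1
  have hc0 : 0 ≤ c := zero_le_one.trans hc.1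
  have hf : Measurable fun z => g (θ + √γ • z) - g θ := by fun_prop
  obtain ⟨-, h2, h3, -, -⟩ := hc.2 _ (by positivity) _ hf (h γ hγ θ)
  have hle := mul_rpow_le_of_mem_Ioc hα hj hγ
  rw [mass_exp_neg_eq g hγ0]
  set M := ∫ z, Real.exp (-(g (θ + √γ • z) - g θ)) ∂(stdMeasure d)
  have hM : 0 < M := (Real.exp_pos _).trans_le h2
  have l2 := (Real.le_log_iff_exp_le hM).2 h2
  have l3 := (Real.log_le_iff_le_exp hM).2 h3
  rw [Real.log_mul (Real.exp_pos _).ne' hM.ne', Real.log_exp, abs_le]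
  have k1 : c * (1 + 2 * j * γ ^ (α / 2)) ^ 2 ≤ c * (1 + 2 * j) ^ 2 := by gcongr
  have k2 : c * (2 * j * γ ^ (α / 2)) ≤ c * (1 + 2 * j) ^ 2 := by gcongr; nlinarith
  constructor <;> linarith

end TiltConst

/-! ### From bounds for each `u` to (S1) and (S2). -/

section Assembly

variable {d : ℕ} {U : Type*} [MeasurableSpace U] {P : Measure U}
  {ell : EuclideanSpace ℝ (Fin d) → U → ℝ} {L : ℝ → EuclideanSpace ℝ (Fin d) → U → ℝ}
  {α β υ : ℝ} {J : U → ℝ}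

lemma HolderExpMoment.hasLinearIncrements (h : HolderExpMoment P ell α β υ J) (u : U) :
    HasLinearIncrements α (J u) (fun x => ell x u) := by
  intro γ hγ θ z
  have := abs_sub_le_of_holder (h.nonneg u) h.alpha_mem.1 h.beta_mem.1
    (fun θ θ' => h.holder θ θ' u) (Real.sqrt_pos.2 hγ.1) (Real.sqrt_le_one.2 hγ.2) θ z
  rwa [show √γ ^ α = γ ^ (α / 2) by
    rw [Real.sqrt_eq_rpow, ← Real.rpow_mul hγ.1.le, one_div_mul_eq_div]] at this

lemma HolderExpMoment.abs_sub_zero_le (h : HolderExpMoment P ell α β υ J) (u : U)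
    (z : EuclideanSpace ℝ (Fin d)) : |ell z u - ell 0 u| ≤ 2 * J u * (1 + ‖z‖) := by
  simpa using h.hasLinearIncrements u 1 ⟨one_pos, le_rfl⟩ 0 z

lemma HolderExpMoment.integrable_one_add_rpow (h : HolderExpMoment P ell α β υ J)
    (hJ : Measurable J) {s : ℝ} (hs : 0 < s) : Integrable (fun u => (1 + J u) ^ s) P :=
  Smoothing.integrable_one_add_rpow hJ h.nonneg h.upsilon_mem.1
    (integrable_exp_mul_of_moment hJ h.nonneg h.upsilon_mem.1 h.moment) hs

/-- The error bound is integrable and independent of `θ` and `γ`, so smoothing lowers the bound on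
the mean by at most a constant. -/
lemma HolderExpMoment.smoothedLowerBound (h : HolderExpMoment P ell α β υ J)
    (hJ : Measurable J) (hlower : LowerBounded P ell) {c : ℝ}
    (hmeas : ∀ γ θ, Measurable (L γ θ))
    (hL : ∀ γ ∈ Ioc (0 : ℝ) 1, ∀ θ u, |L γ θ u - ell θ u| ≤ c * (1 + 2 * J u) ^ 2) :
    SmoothedLowerBound P L := by
  obtain ⟨hint, b, hb⟩ := hlower
  have hi : Integrable (fun u => c * (1 + 2 * J u) ^ 2) P := by
    refine Integrable.const_mul ?_ _
    refine ((h.integrable_one_add_rpow hJ (s := 2) two_pos).const_mul 4).mono'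
      (Measurable.aestronglyMeasurable (by fun_prop)) (ae_of_all _ fun u => ?_)
    have := h.nonneg u
    rw [Real.norm_of_nonneg (by positivity), Real.rpow_two]
    nlinarith
  refine ⟨b - ∫ u, c * (1 + 2 * J u) ^ 2 ∂P, 1, one_pos, fun θ γ hγ => ?_⟩
  have hdiff : Integrable (fun u => L γ θ u - ell θ u) P :=
    hi.mono' ((hmeas γ θ).aestronglyMeasurable.sub (hint θ).aestronglyMeasurable)
      (ae_of_all _ fun u => by rw [Real.norm_eq_abs]; exact hL γ hγ θ u)
  have hLi : Integrable (L γ θ) P :=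
    (hdiff.add (hint θ)).congr (ae_of_all _ fun u => by simp)
  refine ⟨hLi, ?_⟩
  have h1 : b ≤ ∫ u, ell θ u ∂P := hb (mem_range_self θ)
  have h2 : ∫ u, (ell θ u - c * (1 + 2 * J u) ^ 2) ∂P ≤ ∫ u, L γ θ u ∂P :=
    integral_mono ((hint θ).sub hi) hLi fun u => by
      have := (abs_le.1 (hL γ hγ θ u)).1
      dsimp only
      linarith
  rw [integral_sub (hint θ) hi] at h2
  linarith

lemma HolderExpMoment.smoothedRegularity (h : HolderExpMoment P ell α β υ J)
    (hJ : Measurable J) {c : ℝ} (hc : 1 ≤ c)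
    (hL : ∀ u, HasDerivBounds α ((2 + d) * (c * (2 * J u) * (1 + 2 * J u) ^ 3
      + (c * (2 * J u) * (1 + 2 * J u) ^ 3) ^ 2)) (fun γ θ => L γ θ u)) {η : ℝ} (hη : 0 < η) :
    SmoothedRegularity P L α η := by
  have hc0 : 0 ≤ c := zero_le_one.trans hc
  have hd : (0 : ℝ) ≤ d := Nat.cast_nonneg d
  -- With `S ≤ 16 c (1 + J)⁴`, the sum `S + S²` is at most `(16 + 256) c² (1 + J)⁸`, and `512`
  -- leaves room.
  set A : ℝ := (2 + d) * (512 * c ^ 2) with hA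
  have hcc : 1 ≤ c ^ 2 := one_le_pow₀ hc
  have hA1 : 1 ≤ A := by rw [hA]; nlinarith
  have hA0 : 0 ≤ A := zero_le_one.trans hA1
  refine ⟨h.alpha_mem, fun u => A * (1 + J u) ^ 8, 1, zero_lt_one, by fun_prop, fun u => ?_, ?_,
    fun γ' γ h0 hle h1 θ θ' u => ?_⟩
  · have := h.nonneg u
    exact one_le_mul_of_one_le_of_one_le hA1 (one_le_pow₀ (by linarith))
  · refine ((h.integrable_one_add_rpow hJ (s := 8 * η) (by positivity)).const_mul (A ^ η)).congr
      (ae_of_all _ fun u => ?_)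
    have := h.nonneg u
    dsimp only
    rw [Real.mul_rpow hA0 (by positivity), Real.rpow_mul (by positivity)]
    norm_num
  · have hJu := h.nonneg u
    have hS : c * (2 * J u) * (1 + 2 * J u) ^ 3 ≤ 16 * c * (1 + J u) ^ 4 := by
      calc c * (2 * J u) * (1 + 2 * J u) ^ 3
          ≤ c * (2 * (1 + J u)) * (2 * (1 + J u)) ^ 3 := by gcongr <;> linarith
        _ = _ := by ring
    have hB : (2 + d) * (c * (2 * J u) * (1 + 2 * J u) ^ 3
        + (c * (2 * J u) * (1 + 2 * J u) ^ 3) ^ 2) ≤ A * (1 + J u) ^ 8 := by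
      have h8 : c * (1 + J u) ^ 4 ≤ c ^ 2 * (1 + J u) ^ 8 := by
        have : 1 ≤ c * (1 + J u) ^ 4 :=
          one_le_mul_of_one_le_of_one_le hc (one_le_pow₀ (by linarith))
        nlinarith
      calc _ ≤ (2 + d) * (16 * c * (1 + J u) ^ 4 + (16 * c * (1 + J u) ^ 4) ^ 2) := by gcongr
        _ = (2 + d) * (16 * (c * (1 + J u) ^ 4) + 256 * (c ^ 2 * (1 + J u) ^ 8)) := by ring
        _ ≤ (2 + d) * (16 * (c ^ 2 * (1 + J u) ^ 8) + 256 * (c ^ 2 * (1 + J u) ^ 8)) := by gcongr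
        _ ≤ (2 + d) * (512 * (c ^ 2 * (1 + J u) ^ 8)) := by
            gcongr
            have : 0 ≤ c ^ 2 * (1 + J u) ^ 8 := by positivity
            linarith
        _ = _ := by rw [hA]; ring
    exact ((hL u).mono hB).regularity h.alpha_mem.1 (by positivity) h0 hle (by exact_mod_cast h1)
      θ θ'

end Assembly

/-! ### Measurability in `u` and absolute convergence. -/

section Measurability

variable {d : ℕ} {U : Type*} [MeasurableSpace U]

lemma measurable_integral_mul_gaussianDensity {w : EuclideanSpace ℝ (Fin d) → U → ℝ}
    (hw : Measurable fun p : EuclideanSpace ℝ (Fin d) × U => w p.1 p.2) (γ : ℝ)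
    (θ : EuclideanSpace ℝ (Fin d)) :
    Measurable fun u => ∫ x, w x u * gaussianDensity d γ (x - θ) := by
  have h : Measurable fun p : U × EuclideanSpace ℝ (Fin d) =>
      w p.2 p.1 * gaussianDensity d γ (p.2 - θ) := by
    refine (hw.comp measurable_swap).mul ?_
    exact (continuous_gaussianDensity d γ).measurable.comp (measurable_snd.sub_const θ)
  exact h.stronglyMeasurable.integral_prod_right'.measurable

lemma ExpGrowth.integrable_mul_gaussianDensity {w : EuclideanSpace ℝ (Fin d) → ℝ}
    (hw : ExpGrowth w) {γ : ℝ} (hγ : 0 < γ) (θ : EuclideanSpace ℝ (Fin d)) :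
    Integrable fun x => w x * gaussianDensity d γ (x - θ) := by
  have := hw.integrable_smul (p := fun _ => (1 : ℝ)) continuous_const zero_le_one
    (fun y => by simpa using one_le_pow₀ (by linarith [norm_nonneg y])) hγ θ
  simpa using this

end Measurability

end Smoothing

end

/-! ### The two smoothings. -/

theorem proposition2 {d : ℕ} {U : Type*} [MeasurableSpace U] (P : Measure U)
    [IsProbabilityMeasure P] (ell : EuclideanSpace ℝ (Fin d) → U → ℝ)
    (hell : Measurable (fun p : EuclideanSpace ℝ (Fin d) × U => ell p.1 p.2))
    (α β υ : ℝ) (J : U → ℝ) (hJ : Measurable J)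
    (hlower : Smoothing.LowerBounded P ell)
    (hholder : Smoothing.HolderExpMoment P ell α β υ J) :
    ((∀ γ : ℝ, 0 < γ → ∀ θ u,
        Integrable (fun x => ell x u * Smoothing.gaussianDensity d γ (x - θ)) volume) ∧
      Smoothing.SmoothedLowerBound P (Smoothing.gaussianSmoothing ell) ∧
      ∀ η : ℝ, 0 < η →
        Smoothing.SmoothedRegularity P (Smoothing.gaussianSmoothing ell) α η) ∧
    ((∀ γ : ℝ, 0 < γ → ∀ θ u,
        Integrable (fun x => Real.exp (-ell x u) * Smoothing.gaussianDensity d γ (x - θ))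
          volume) ∧
      Smoothing.SmoothedLowerBound P (Smoothing.logSumExpSmoothing ell) ∧
      ∀ η : ℝ, 0 < η →
        Smoothing.SmoothedRegularity P (Smoothing.logSumExpSmoothing ell) α η) := by
  obtain ⟨c, hc⟩ := Smoothing.exists_isTiltConst d
  have hα := hholder.alpha_mem.1
  have hJ0 := hholder.nonneg
  have hm : ∀ u, Measurable fun x => ell x u := fun u => hell.comp measurable_prodMk_right
  have hlin := hholder.hasLinearIncrements
  have hG : ∀ u, Smoothing.ExpGrowth fun x => ell x u := fun u =>
    Smoothing.expGrowth_of_abs_sub_le (hm u) (mul_nonneg zero_le_two (hJ0 u))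
      (hholder.abs_sub_zero_le u)
  have hE : ∀ u, Smoothing.ExpGrowth fun x => Real.exp (-ell x u) := fun u =>
    Smoothing.expGrowth_exp_neg_of_abs_sub_le (hm u) (mul_nonneg zero_le_two (hJ0 u))
      (hholder.abs_sub_zero_le u)
  have hS : ∀ u, 0 ≤ c * (2 * J u) * (1 + 2 * J u) ^ 3 := fun u => by
    have := hJ0 u
    have := hc.1
    positivity
  have eG : ∀ γ θ u, Smoothing.gaussianSmoothing ell γ θ u
      = Smoothing.mass (fun x => ell x u) γ θ := fun γ θ u =>
    (Smoothing.mass_eq_integral _ γ θ).symm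
  have eE : ∀ γ θ u, Smoothing.logSumExpSmoothing ell γ θ u
      = -Real.log (Smoothing.mass (fun x => Real.exp (-ell x u)) γ θ) := fun γ θ u => by
    rw [Smoothing.mass_eq_integral]; rfl
  refine ⟨⟨fun γ hγ θ u => (hG u).integrable_mul_gaussianDensity hγ θ, ?_, fun η hη => ?_⟩,
    ⟨fun γ hγ θ u => (hE u).integrable_mul_gaussianDensity hγ θ, ?_, fun η hη => ?_⟩⟩
  · refine hholder.smoothedLowerBound (c := c) hJ hlower
      (Smoothing.measurable_integral_mul_gaussianDensity hell) fun γ hγ θ u => ?_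
    rw [eG]
    exact (hlin u).abs_mass_sub_le (hm u) hα (hJ0 u) hc hγ θ
  · refine hholder.smoothedRegularity hJ hc.1 (fun u => ?_) hη
    simp only [eG]
    -- The Gaussian case needs only `S`; the bound is enlarged to `S + S ^ 2` to share the constant
    -- of the logarithmic case.
    refine (((hlin u).hasCentredBounds (hm u) (hJ0 u) hc).hasDerivBounds_mass (hG u)
      (hS u)).mono ?_
    gcongr
    exact le_add_of_nonneg_right (sq_nonneg _)
  · refine hholder.smoothedLowerBound (c := c) hJ hlower (fun γ θ =>
      (Smoothing.measurable_integral_mul_gaussianDensity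
        (w := fun x u => Real.exp (-ell x u)) hell.neg.exp γ θ).log.neg) fun γ hγ θ u => ?_
    rw [eE]
    exact (hlin u).abs_neg_log_mass_sub_le (hm u) hα (hJ0 u) hc hγ θ
  · refine hholder.smoothedRegularity hJ hc.1 (fun u => ?_) hη
    simp only [eE]
    exact ((hlin u).hasCentredBounds_exp_neg (hm u) hα (hJ0 u) hc).hasDerivBounds_neg_log_mass
      (hE u) hα (hS u) fun γ hγ θ => (hlin u).mass_exp_neg_pos (hm u) (hJ0 u) hc hγ θ
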